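/- Let $R$ be an algebraically closed field and let $G$ be a locally profinite group with center $Z$, having a compact open subgroup whose pro-order is invertible in $R$ (that is, the index of each of its open subgroups is invertible in $R$). Let $N$ be a closed subgroup of $G$ exhausted by compact subgroups of invertible pro-order in $R$ (every compact subset of $N$ lies in such a subgroup), and let $\theta : N \to R^\times$ be a smooth character. Let $(\pi,V)$ be an irreducible admissible smooth $R$-representation of $G$ with contragredient $\pi^\vee$, and suppose that $\pi$ is $Z$-compact: every matrix coefficient $g \mapsto \langle v^\vee, \pi(g)v\rangle$, with $v^\vee\in\pi^\vee$ and $v\in\pi$, has compact support modulo $Z$. Let $\omega_\pi : Z \to R^\times$ be the central character of $\pi$. Assume that $ZN$ is closed in $G$, that $\omega_\pi$ agrees with $\theta$ on $Z\cap N$, and that the resulting character $[\omega_\pi\theta](zn) = \omega_\pi(z)\theta(n)$ of $ZN$ is smooth. Let $\operatorname{Hom}_N(\pi,\theta)$ be the space of linear forms $L$ on $V$ with $L(\pi(n)v)=\theta(n)L(v)$ for all $n\in N$, $v\in V$, and suppose that $d_\theta(\pi)=\dim\operatorname{Hom}_N(\pi,\theta)$ is finite. For a closed subgroup $H$ of $G$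 and a smooth character $\chi$ of $H$, let $\operatorname{Ind}_H^G(\chi)$ be the space of functions $f:G\to R$ that are right invariant under some open subgroup of $G$ and satisfy $f(hg)=\chi(h)f(g)$ for $h\in H$, $g\in G$, with $G$ acting by right translation, and let $\operatorname{ind}_H^G(\chi)$ be the subspace of those with compact support modulo $H$. Then: 1. Every Whittaker model of $\pi$, i.e. the image of any $G$-equivariant embedding $\pi\hookrightarrow\operatorname{Ind}_N^G(\theta)$, is contained in $\operatorname{ind}_{ZN}^G([\omega_\pi\theta])$. 2. For all $v^\vee\in\pi^\vee$ and $v\in\pi$, the function $Zn\mapsto\theta^{-1}(n)\langle v^\vee,\pi(n)v\rangle$ on $Z\backslash ZN$ is well defined, locally constant and compactly supported. The group $Z\backslash ZN$ has compact open subgroups of pro-order invertible in $R$, and for the $R$-valued Haar measure $dn$ on $Z\backslash ZN$ giving any chosen one of them volume $1$, the Whittaker periods $$W_{v^\vee} : v\mapsto \int_{Z\backslash ZN}\theta^{-1}(n)\,\langle v^\vee,\pi(n)v\rangle\,dn$$ satisfy $$\operatorname{Hom}_N(\pi,\theta)=\{W_{v^\vee}\ :\ v^\vee\in\pi^\vee\}.$$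 -/

import Mathlib

open scoped Pointwise

/-! ### Compact groups of invertible pro-order -/

/-- The pro-order of the (compact) topological group `K` is invertible in `R`: the index of every
open subgroup of `K` is invertible in `R`. -/
def HasInvertibleProOrder (R : Type*) [CommRing R] (K : Type*) [Group K] [TopologicalSpace K] :
    Prop :=
  ∀ U : OpenSubgroup K, IsUnit ((U.toSubgroup.index : ℕ) : R)

/-- `N` is exhausted by compact subgroups of invertible pro-order in `R`: every compact subset
of `N` is contained in such a subgroup. -/
def IsExhaustedByCompacts (R : Type*) [CommRing R] (N : Type*) [Group N] [TopologicalSpace N] :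
    Prop :=
  ∀ C : Set N, IsCompact C →
    ∃ K : Subgroup N, IsCompact (K : Set N) ∧ HasInvertibleProOrder R K ∧ C ⊆ K

/-! ### Smooth characters and smooth representations -/

/-- A character is smooth if it is trivial on an open subgroup. -/
def IsSmoothChar {R : Type*} [CommRing R] {H : Type*} [Group H] [TopologicalSpace H]
    (χ : H →* Rˣ) : Prop :=
  ∃ U : OpenSubgroup H, ∀ u ∈ U, χ u = 1

section Representations

variable {R : Type*} [Field R] {G : Type*} [Group G] [TopologicalSpace G]
  {V : Type*} [AddCommGroup V] [Module R V]

/-- Every vector is fixed by an open subgroup. -/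
def IsSmoothRep (π : Representation R G V) : Prop :=
  ∀ v : V, ∃ U : OpenSubgroup G, ∀ u ∈ U, π u v = v

/-- The subspace of vectors fixed by a subgroup `K`. -/
def fixedVectors (π : Representation R G V) (K : Subgroup G) : Submodule R V where
  carrier := {v | ∀ k ∈ K, π k v = v}
  add_mem' := fun {a b} ha hb k hk => by rw [map_add, ha k hk, hb k hk]
  zero_mem' := fun k _ => map_zero _
  smul_mem' := fun c v hv k hk => by rw [map_smul, hv k hk]

/-- The vectors fixed by any compact open subgroup form a finite-dimensional space. -/
def IsAdmissibleRep (π : Representation R G V) : Prop :=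
  ∀ K : OpenSubgroup G, IsCompact (K : Set G) →
    FiniteDimensional R (fixedVectors π K.toSubgroup)

/-- The space of the contragredient `π^∨`: the smooth vectors of the dual representation. -/
def contragredient (π : Representation R G V) : Submodule R (Module.Dual R V) where
  carrier := {f | ∃ U : OpenSubgroup G, ∀ u ∈ U, π.dual u f = f}
  add_mem' := by
    rintro a b ⟨U, hU⟩ ⟨U', hU'⟩
    refine ⟨U ⊓ U', fun u hu => ?_⟩
    obtain ⟨h1, h2⟩ := OpenSubgroup.mem_inf.mp hu
    rw [map_add, hU u h1, hU' u h2]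
  zero_mem' := ⟨⊤, fun u _ => map_zero _⟩
  smul_mem' := by
    rintro c f ⟨U, hU⟩
    exact ⟨U, fun u hu => by rw [map_smul, hU u hu]⟩

/-- The matrix coefficient `g ↦ ⟨v^∨, π(g) v⟩`. -/
def matrixCoeff (π : Representation R G V) (vd : Module.Dual R V) (v : V) (g : G) : R :=
  vd (π g v)

/-- `f` has compact support modulo `H` (on the left): its support lies in `H C`, `C` compact. -/
def HasCompactSupportMod (H : Subgroup G) (f : G → R) : Prop :=
  ∃ C : Set G, IsCompact C ∧ Function.support f ⊆ (H : Set G) * C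

/-- All matrix coefficients of `π` have compact support modulo the center. -/
def IsZCompact (π : Representation R G V) : Prop :=
  ∀ vd ∈ contragredient π, ∀ v : V,
    HasCompactSupportMod (Subgroup.center G) (matrixCoeff π vd v)

open Classical in
/-- The central character `ω_π`: the character through which the center acts (and the trivial
character if the center does not act through a character). -/
noncomputable def centralCharacter (π : Representation R G V) : Subgroup.center G →* Rˣ :=
  if h : ∃ ω : Subgroup.center G →* Rˣ, ∀ (z : Subgroup.center G) (v : V),
      π (z : G) v = (ω z : R) • v
  then h.choose else 1

/-! ### Induced representations and Whittaker models -/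

/-- The space of `Ind_H^G(χ)`: functions `f : G → R` with `f (h g) = χ(h) f(g)` that are
right invariant under some open subgroup. -/
def smoothInd (H : Subgroup G) (χ : H →* Rˣ) : Submodule R (G → R) where
  carrier := {f | (∀ (h : H) (g : G), f (h * g) = (χ h : R) * f g) ∧
    ∃ U : OpenSubgroup G, ∀ (g : G), ∀ u ∈ U, f (g * u) = f g}
  add_mem' := by
    rintro a b ⟨ha, U, hU⟩ ⟨hb, U', hU'⟩
    refine ⟨fun h g => by simp only [Pi.add_apply, ha, hb, mul_add], U ⊓ U', fun g u hu => ?_⟩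
    obtain ⟨h1, h2⟩ := OpenSubgroup.mem_inf.mp hu
    simp only [Pi.add_apply, hU g u h1, hU' g u h2]
  zero_mem' := ⟨fun _ _ => by simp, ⊤, fun _ _ _ => rfl⟩
  smul_mem' := by
    rintro c f ⟨hf, U, hU⟩
    refine ⟨fun h g => ?_, U, fun g u hu => ?_⟩
    · simp only [Pi.smul_apply, smul_eq_mul, hf]; ring
    · simp only [Pi.smul_apply, hU g u hu]

/-- The space of `ind_H^G(χ)`: the functions in `Ind_H^G(χ)` with compact support modulo `H`. -/
def compactInd (H : Subgroup G) (χ : H →* Rˣ) : Submodule R (G → R) where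
  carrier := {f | f ∈ smoothInd H χ ∧ HasCompactSupportMod H f}
  add_mem' := by
    rintro a b ⟨ha, C, hC, hCa⟩ ⟨hb, C', hC', hCb⟩
    refine ⟨add_mem ha hb, C ∪ C', hC.union hC', ?_⟩
    rw [Set.mul_union]
    exact (Function.support_add a b).trans (Set.union_subset_union hCa hCb)
  zero_mem' := ⟨zero_mem _, ∅, isCompact_empty, by simp⟩
  smul_mem' := by
    rintro c f ⟨hf, C, hC, hCf⟩
    exact ⟨Submodule.smul_mem _ c hf, C, hC, (Function.support_const_smul_subset c f).trans hCf⟩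

/-- `G` acts on `Ind_H^G(χ)` by right translation. -/
def smoothIndRep [IsTopologicalGroup G] (H : Subgroup G) (χ : H →* Rˣ) :
    Representation R G (smoothInd H χ) where
  toFun g :=
    { toFun := fun f => ⟨fun x => (f : G → R) (x * g), by
        obtain ⟨f, hf, U, hU⟩ := f
        refine ⟨fun h x => by simp only [mul_assoc, hf], ?_⟩
        refine ⟨U.comap (MulAut.conj g⁻¹).toMonoidHom (by
          have hc : Continuous fun x : G => g⁻¹ * x * g⁻¹⁻¹ := by fun_prop
          exact hc), fun x u hu => ?_⟩
        have h2 : g⁻¹ * u * g ∈ U := by simpa using hu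
        have h3 := hU (x * g) _ h2
        simp only [← h3]
        congr 1
        group⟩
      map_add' := fun _ _ => rfl
      map_smul' := fun _ _ => rfl }
  map_one' := by ext f x; simp
  map_mul' a b := by ext f x; simp [mul_assoc]

/-- A Whittaker model of `π` with respect to `(N, θ)`: the image of a `G`-embedding of `π`
into `Ind_N^G(θ)`. -/
def IsWhittakerModel [IsTopologicalGroup G] (π : Representation R G V) {N : Subgroup G}
    (θ : N →* Rˣ) (W : Submodule R (G → R)) : Prop :=
  ∃ L : Representation.IntertwiningMap π (smoothIndRep N θ),
    Function.Injective L ∧ W = (LinearMap.range L.toLinearMap).map (smoothInd N θ).subtype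

/-- The Whittaker space `Hom_N(π, θ)`. -/
def whittakerSpace (π : Representation R G V) {N : Subgroup G} (θ : N →* Rˣ) :
    Submodule R (Module.Dual R V) where
  carrier := {f | ∀ (n : N) (v : V), f (π (n : G) v) = (θ n : R) * f v}
  add_mem' := fun {a b} ha hb n v => by simp only [LinearMap.add_apply, ha n v, hb n v, mul_add]
  zero_mem' := fun _ _ => by simp
  smul_mem' := fun c f hf n v => by
    simp only [LinearMap.smul_apply, smul_eq_mul, hf n v]; ring

end Representations

/-! ### The character `[ω θ]` of `Z N` -/

section CentralProduct

variable {R : Type*} [Field R] {G : Type*} [Group G]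

theorem exists_center_mul {N : Subgroup G} (x : ↥(Subgroup.center G ⊔ N)) :
    ∃ p : Subgroup.center G × N, (p.1 : G) * p.2 = x := by
  obtain ⟨z, hz, n, hn, h⟩ := Subgroup.mem_sup_of_normal_left.mp x.2
  exact ⟨(⟨z, hz⟩, ⟨n, hn⟩), h⟩

theorem centerMul_welldefined {N : Subgroup G} (ω : Subgroup.center G →* Rˣ) (θ : N →* Rˣ)
    (h : ∀ (g : G) (hz : g ∈ Subgroup.center G) (hn : g ∈ N), ω ⟨g, hz⟩ = θ ⟨g, hn⟩)
    (z z' : Subgroup.center G) (n n' : N) (e : (z : G) * n = z' * n') :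
    ω z * θ n = ω z' * θ n' := by
  have e2 : (z' : G)⁻¹ * z = n' * (n : G)⁻¹ := by
    rw [inv_mul_eq_iff_eq_mul, ← mul_assoc, ← e, mul_inv_cancel_right]
  have hn : (z' : G)⁻¹ * z ∈ N := e2 ▸ N.mul_mem n'.2 (N.inv_mem n.2)
  have h1 := h _ (z'⁻¹ * z).2 hn
  have h2 : (⟨((z'⁻¹ * z : Subgroup.center G) : G), hn⟩ : N) = n' * n⁻¹ := Subtype.ext e2
  rw [h2, Subtype.coe_eta, map_mul, map_mul, map_inv, map_inv, inv_mul_eq_iff_eq_mul] at h1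
  rw [h1]
  simp [mul_assoc]

/-- The character `[ω θ] : z n ↦ ω(z) θ(n)` of `Z N`, for `ω` and `θ` that agree on `Z ∩ N`. -/
noncomputable def centralMulChar {N : Subgroup G} (ω : Subgroup.center G →* Rˣ) (θ : N →* Rˣ)
    (h : ∀ (g : G) (hz : g ∈ Subgroup.center G) (hn : g ∈ N), ω ⟨g, hz⟩ = θ ⟨g, hn⟩) :
    ↥(Subgroup.center G ⊔ N) →* Rˣ :=
  MonoidHom.mk'
    (fun x => ω (exists_center_mul x).choose.1 * θ (exists_center_mul x).choose.2)
    (fun x y => by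
      have hx := (exists_center_mul x).choose_spec
      have hy := (exists_center_mul y).choose_spec
      have hxy := (exists_center_mul (x * y)).choose_spec
      generalize (exists_center_mul x).choose = p at hx ⊢
      generalize (exists_center_mul y).choose = q at hy ⊢
      generalize (exists_center_mul (x * y)).choose = r at hxy ⊢
      have key : (r.1 : G) * r.2 = ((p.1 * q.1 : Subgroup.center G) : G) * (p.2 * q.2 : N) := by
        have hc := Subgroup.mem_center_iff.mp q.1.2 (p.2 : G)
        rw [hxy, Subgroup.coe_mul, ← hx, ← hy, Subgroup.coe_mul, Subgroup.coe_mul]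
        simp only [mul_assoc]
        rw [← mul_assoc (p.2 : G) (q.1 : G), hc, mul_assoc]
      rw [centerMul_welldefined ω θ h _ _ _ _ key, map_mul, map_mul]
      exact mul_mul_mul_comm _ _ _ _)

theorem centralMulChar_apply {N : Subgroup G} (ω : Subgroup.center G →* Rˣ) (θ : N →* Rˣ)
    (h : ∀ (g : G) (hz : g ∈ Subgroup.center G) (hn : g ∈ N), ω ⟨g, hz⟩ = θ ⟨g, hn⟩)
    (x : ↥(Subgroup.center G ⊔ N)) (z : Subgroup.center G) (n : N) (e : (z : G) * n = x) :
    centralMulChar ω θ h x = ω z * θ n :=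
  centerMul_welldefined ω θ h _ _ _ _ ((exists_center_mul x).choose_spec.trans e.symm)

/-- The quotient group `Z \ Z N`, with the quotient topology. -/
abbrev CenterQuotient (N : Subgroup G) : Type _ :=
  ↥(Subgroup.center G ⊔ N) ⧸ (Subgroup.center G).subgroupOf (Subgroup.center G ⊔ N)

end CentralProduct

/-! ### `R`-valued Haar integral and Whittaker periods -/

open Classical in
/-- The integral of a locally constant compactly supported function `F : Q → R` for the right
invariant Haar measure on `Q` giving volume `1` to the compact open subgroup `K` of invertible
pro-order: if `U ≤ K` is an open subgroup under which `F` is left invariant, it is the sum of `F`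
over `U \ Q` times the volume `[K : U]⁻¹` of `U`. The value does not depend on `U`. -/
noncomputable def haarIntegral {R : Type*} [Field R] {Q : Type*} [Group Q] [TopologicalSpace Q]
    (K : OpenSubgroup Q) (F : Q → R) : R :=
  if h : ∃ U : OpenSubgroup Q, U ≤ K ∧ ∀ u ∈ U, ∀ x, F (u * x) = F x then
    ((h.choose.toSubgroup.relIndex K.toSubgroup : ℕ) : R)⁻¹ *
      ∑ᶠ x : Quotient (QuotientGroup.rightRel h.choose.toSubgroup), F x.out
  else 0

section Periods

variable {R : Type*} [Field R] {G : Type*} [Group G]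
  {V : Type*} [AddCommGroup V] [Module R V]

/-- The function `Z n ↦ θ⁻¹(n) ⟨v^∨, π(n) v⟩` on `Z \ Z N`, written with `χ = [ω_π θ]` as
`Z x ↦ χ⁻¹(x) ⟨v^∨, π(x) v⟩`; it does not depend on the representative `x ∈ Z N` since the
center acts through `ω_π`. -/
noncomputable def periodIntegrand (π : Representation R G V) {N : Subgroup G}
    (χ : ↥(Subgroup.center G ⊔ N) →* Rˣ) (vd : Module.Dual R V) (v : V)
    (q : CenterQuotient N) : R :=
  ((χ q.out)⁻¹ : Rˣ) * matrixCoeff π vd v (q.out : G)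

theorem periodIntegrand_mk (π : Representation R G V) {N : Subgroup G} (θ : N →* Rˣ)
    (ω : Subgroup.center G →* Rˣ) (hω : ∀ (z : Subgroup.center G) (v : V), π z v = (ω z : R) • v)
    (h : ∀ (g : G) (hz : g ∈ Subgroup.center G) (hn : g ∈ N), ω ⟨g, hz⟩ = θ ⟨g, hn⟩)
    (vd : Module.Dual R V) (v : V) (n : N) :
    periodIntegrand π (centralMulChar ω θ h) vd v
        (QuotientGroup.mk ⟨(n : G), le_sup_right (a := Subgroup.center G) n.2⟩) =
      ((θ n)⁻¹ : Rˣ) * vd (π n v) := by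
  unfold periodIntegrand matrixCoeff
  set q : CenterQuotient N :=
    QuotientGroup.mk ⟨(n : G), le_sup_right (a := Subgroup.center G) n.2⟩ with hq
  have h1 : (QuotientGroup.mk q.out : CenterQuotient N) = q := Quotient.out_eq q
  rw [hq, QuotientGroup.eq, Subgroup.mem_subgroupOf] at h1
  rw [← hq] at h1
  have h2 : (q.out : G)⁻¹ * n ∈ Subgroup.center G := by simpa using h1
  have h3 := (Subgroup.center G).inv_mem h2
  generalize (q.out : ↥(Subgroup.center G ⊔ N)) = y at h3 ⊢
  have e : ((⟨_, h3⟩ : Subgroup.center G) : G) * n = (y : G) := by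
    have hc := Subgroup.mem_center_iff.mp h3 (n : G)
    rw [← hc]
    simp
  rw [centralMulChar_apply ω θ h y ⟨_, h3⟩ n e]
  generalize (⟨_, h3⟩ : Subgroup.center G) = z at e ⊢
  rw [← e, map_mul, Module.End.mul_apply, hω, map_smul, smul_eq_mul, mul_inv_rev, Units.val_mul,
    mul_assoc, Units.inv_mul_cancel_left]

variable [TopologicalSpace G]

/-- The Whittaker period `W_{v^∨} : v ↦ ∫_{Z \ Z N} θ⁻¹(n) ⟨v^∨, π(n) v⟩ dn`, where `χ = [ω_π θ]`
and the Haar measure on `Z \ Z N` is normalized by `K`. -/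
noncomputable def whittakerPeriod (π : Representation R G V) {N : Subgroup G}
    (χ : ↥(Subgroup.center G ⊔ N) →* Rˣ) (K : OpenSubgroup (CenterQuotient N))
    (vd : Module.Dual R V) (v : V) : R :=
  haarIntegral K (periodIntegrand π χ vd v)

end Periods

/-! ### Sums over coset spaces of functions invariant under a subgroup. -/

section CosetSums

variable {P : Type*} [Group P] {A : Type*} [AddCommMonoid A]

/-! Twisting $\pi|_{ZN}$ by the inverse of $[\omega_\pi\theta]$ makes $Z$ act trivially and gives a
smooth representation $\rho$ of $Q = Z\backslash ZN$ (`centerQuotientRep`). The Whittaker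
functionals are the $Q$-invariant forms (`mem_whittakerSpace_iff`), and $Z$-compactness makes the
coefficients $q\mapsto l(\rho(q)v)$, $l\in\pi^\vee$, compactly supported. Since $N$ surjects onto
$Q$, every finite subset of $Q$ lies in a subgroup $P$ of invertible pro-order. With $e_P$ the
averaging projection over $P$, the integral of a coefficient is $[P:P\cap K]\,l(e_Pv)$ for all large
enough $P$ (`haarIntegral_coeff_eq`). Hence the periods are linear in $l$ and $v$ and $Q$-invariant.

They therefore form a subspace of the finite-dimensional space $\operatorname{Hom}_N(\pi,\theta)$,
and by duality it is everything once each $v$ killed by all periods is killed by every invariant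
form $m$ (`apply_eq_zero_of_haarIntegral_eq_zero`). Fix $l\ne 0$ in $\pi^\vee$ and consider all
translates $l\circ\pi(g)$. The supports of their coefficients at $v$ have uniformly bounded size: if
$q,q'$ lie in one of them, $q^{-1}q'$ lies in a compact set independent of $g$. So a single $P$
serves every $g$: each support either misses $P$ or lies in $PM$, where $M$ is an open subgroup
fixing $v$, and in both cases $l(\pi(g)e_Pv)=0$ (`exists_average_of_haarIntegral_eq_zero`). By
irreducibility $e_Pv=0$, whence $m(v)=m(e_Pv)=0$.

A Whittaker model consists of functions $g\mapsto L(\pi(g)v)$ with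
$L\in\operatorname{Hom}_N(\pi,\theta)$. As $L$ is a period, a nonzero value at $g$ forces a
coefficient to be nonzero on $ZNg$, which confines $g$ to a compact set modulo $ZN$. -/

theorem apply_out_mk_of_rightInvariant {B : Type*} {U : Subgroup P} {f : P → B}
    (hf : ∀ x, ∀ u ∈ U, f (x * u) = f x) (x : P) : f (QuotientGroup.mk x : P ⧸ U).out = f x := by
  obtain ⟨u, hu⟩ := QuotientGroup.mk_out_eq_mul U x
  rw [hu, hf x u u.2]

theorem finsum_quotient_translate {U : Subgroup P} {f : P → A}
    (hf : ∀ x, ∀ u ∈ U, f (x * u) = f x) (p : P) :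
    ∑ᶠ x : P ⧸ U, f (p * x.out) = ∑ᶠ x : P ⧸ U, f x.out := by
  rw [← finsum_comp_equiv (MulAction.toPerm p : Equiv.Perm (P ⧸ U)) (f := fun x => f x.out)]
  refine finsum_congr fun x => ?_
  induction x using QuotientGroup.induction_on with
  | H x =>
    have h1 := apply_out_mk_of_rightInvariant (f := fun x => f (p * x))
      (fun x u hu => by rw [← mul_assoc, hf _ u hu]) x
    exact h1.trans (apply_out_mk_of_rightInvariant hf (p * x)).symm

theorem finsum_quotient_mul_right {U U' : Subgroup P} {f : P → A}
    (hf : ∀ x, ∀ u ∈ U, f (x * u) = f x) (p : P) (hU : ∀ u, u ∈ U' ↔ p⁻¹ * u * p ∈ U) :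
    ∑ᶠ x : P ⧸ U', f (x.out * p) = ∑ᶠ x : P ⧸ U, f x.out := by
  let e : P ⧸ U' ≃ P ⧸ U := Quotient.congr (Equiv.mulRight p) (fun a b => by
    change QuotientGroup.leftRel U' a b ↔ QuotientGroup.leftRel U (a * p) (b * p)
    rw [QuotientGroup.leftRel_apply, QuotientGroup.leftRel_apply, hU]
    simp only [mul_inv_rev, mul_assoc])
  rw [← finsum_comp_equiv e (f := fun x => f x.out)]
  refine finsum_congr fun x => ?_
  induction x using QuotientGroup.induction_on with
  | H x =>
    have h1 := apply_out_mk_of_rightInvariant (U := U') (f := fun x => f (x * p))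
      (fun x u hu => by
        have := hf (x * p) _ ((hU u).1 hu)
        rw [← this]; congr 1; group) x
    exact h1.trans (apply_out_mk_of_rightInvariant hf (x * p)).symm

/-- Each coset of `U` splits into `[U : U']` cosets of `U'`, on all of which `f` takes the same
value. -/
theorem finsum_quotient_refine {U U' : Subgroup P} (h : U' ≤ U) [U'.FiniteIndex] {f : P → A}
    (hf : ∀ x, ∀ u ∈ U, f (x * u) = f x) :
    ∑ᶠ x : P ⧸ U', f x.out = U'.relIndex U • ∑ᶠ x : P ⧸ U, f x.out := by
  have : U.FiniteIndex := Subgroup.finiteIndex_of_le h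
  have : (U'.subgroupOf U).FiniteIndex := inferInstance
  let := Fintype.ofFinite (P ⧸ U)
  let := Fintype.ofFinite (U ⧸ U'.subgroupOf U)
  have h1 : ∀ x : P ⧸ U',
      f x.out = f (Subgroup.quotientEquivProdOfLE h x).1.out := by
    intro x
    induction x using QuotientGroup.induction_on with
    | H x =>
      rw [apply_out_mk_of_rightInvariant (fun y u hu => hf y u (h hu))]
      exact (apply_out_mk_of_rightInvariant hf x).symm
  rw [finsum_congr h1, finsum_comp_equiv (Subgroup.quotientEquivProdOfLE h)
    (f := fun y => f y.1.out), finsum_eq_sum_of_fintype, Fintype.sum_prod_type,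
    finsum_eq_sum_of_fintype, Finset.smul_sum]
  simp [Subgroup.relIndex, Subgroup.index, Nat.card_eq_fintype_card]

/-- `S / (S ∩ U)` embeds in `P / U`, and the cosets in its image are the only ones that can meet the
support. -/
theorem finsum_quotient_eq_of_support_subset {U : Subgroup P} {f : P → A}
    (hf : ∀ x, ∀ u ∈ U, f (x * u) = f x) (S : Subgroup P)
    (hS : Function.support f ⊆ (S : Set P) * (U : Set P)) :
    ∑ᶠ x : P ⧸ U, f x.out = ∑ᶠ x : S ⧸ U.subgroupOf S, f x.out := by
  let j : S ⧸ U.subgroupOf S → P ⧸ U := Quotient.map' (fun s : S => (s : P)) (fun a b h => by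
    rw [QuotientGroup.leftRel_apply] at h ⊢
    exact h)
  have hjmk : ∀ s : S, j (QuotientGroup.mk s) = QuotientGroup.mk (s : P) := fun s => rfl
  have hj : Function.Injective j := by
    intro a b
    induction a using QuotientGroup.induction_on with
    | H a =>
      induction b using QuotientGroup.induction_on with
      | H b =>
        rw [hjmk, hjmk, QuotientGroup.eq, QuotientGroup.eq]
        exact id
  have h1 : ∀ x : S ⧸ U.subgroupOf S, f x.out = f (j x).out := by
    intro x
    induction x using QuotientGroup.induction_on with
    | H x =>
      rw [hjmk, apply_out_mk_of_rightInvariant hf]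
      exact apply_out_mk_of_rightInvariant (f := fun s : S => f s) (fun y u hu => hf y u hu) x
  rw [finsum_congr h1, ← finsum_mem_range (f := fun x => f x.out) hj]
  rw [← finsum_mem_univ]
  refine finsum_mem_inter_support_eq' _ _ _ fun x hx => iff_of_true trivial ?_
  induction x using QuotientGroup.induction_on with
  | H x =>
    rw [Function.mem_support, apply_out_mk_of_rightInvariant hf] at hx
    obtain ⟨s, hs, u, hu, rfl⟩ := hS hx
    refine ⟨QuotientGroup.mk ⟨s, hs⟩, ?_⟩
    rw [hjmk, QuotientGroup.eq]
    simpa using hu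

end CosetSums

/-! ### Averaging over a group of invertible pro-order. -/

section Averaging

variable {R : Type*} [Field R] {P : Type*} [Group P] [TopologicalSpace P]
  {V : Type*} [AddCommGroup V] [Module R V]

theorem HasInvertibleProOrder.index_ne_zero (hP : HasInvertibleProOrder R P)
    (U : OpenSubgroup P) : (U.toSubgroup.index : R) ≠ 0 := (hP U).ne_zero

theorem HasInvertibleProOrder.finiteIndex (hP : HasInvertibleProOrder R P)
    (U : OpenSubgroup P) : U.toSubgroup.FiniteIndex :=
  ⟨fun h => hP.index_ne_zero U (by rw [h, Nat.cast_zero])⟩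

theorem Representation.apply_mul_fixed {P : Type*} [Group P] (ρ : Representation R P V)
    {U : Subgroup P} {v : V}
    (hv : ∀ u ∈ U, ρ u v = v) (x : P) (u : P) (hu : u ∈ U) : ρ (x * u) v = ρ x v := by
  rw [map_mul, Module.End.mul_apply, hv u hu]

/-- The average of the orbit of `v` over `P`, computed on the cosets of `U`. -/
noncomputable def orbitAverage (ρ : Representation R P V) (U : OpenSubgroup P) (v : V) : V :=
  (U.toSubgroup.index : R)⁻¹ • ∑ᶠ x : P ⧸ U.toSubgroup, ρ x.out v

theorem orbitAverage_eq_of_le (hP : HasInvertibleProOrder R P) (ρ : Representation R P V)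
    {U U' : OpenSubgroup P} (h : U' ≤ U) {v : V} (hv : ∀ u ∈ U, ρ u v = v) :
    orbitAverage ρ U' v = orbitAverage ρ U v := by
  have := hP.finiteIndex U'
  have h1 : U'.toSubgroup.relIndex U.toSubgroup * U.toSubgroup.index = U'.toSubgroup.index :=
    Subgroup.relIndex_mul_index h
  have h2 := hP.index_ne_zero U'
  rw [← h1, Nat.cast_mul] at h2
  unfold orbitAverage
  rw [finsum_quotient_refine (U := U.toSubgroup) (U' := U'.toSubgroup) h (f := fun x => ρ x v)
    (Representation.apply_mul_fixed ρ hv), ← h1,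
    ← Nat.cast_smul_eq_nsmul R, smul_smul, Nat.cast_mul, mul_inv, mul_comm, ← mul_assoc,
    mul_inv_cancel₀ (left_ne_zero_of_mul h2), one_mul]

theorem orbitAverage_eq (hP : HasInvertibleProOrder R P) (ρ : Representation R P V)
    {U U' : OpenSubgroup P} {v : V} (hv : ∀ u ∈ U, ρ u v = v) (hv' : ∀ u ∈ U', ρ u v = v) :
    orbitAverage ρ U' v = orbitAverage ρ U v := by
  rw [← orbitAverage_eq_of_le hP ρ (inf_le_left : U ⊓ U' ≤ U) hv,
    orbitAverage_eq_of_le hP ρ (inf_le_right : U ⊓ U' ≤ U') hv']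

/-- The averaging projection of a smooth representation of a group of invertible pro-order. -/
structure IsAveraging (ρ : Representation R P V) (e : V →ₗ[R] V) : Prop where
  fixed : ∀ p v, ρ p (e v) = e v
  invariant : ∀ p v, e (ρ p v) = e v
  index_smul : ∀ (U : OpenSubgroup P) (v : V), (∀ u ∈ U, ρ u v = v) →
    (U.toSubgroup.index : R) • e v = ∑ᶠ x : P ⧸ U.toSubgroup, ρ x.out v

/-- Averaging over a group of invertible pro-order: a linear projection onto the fixed vectors
of a smooth representation. -/
theorem exists_averagingProjection [IsTopologicalGroup P] (hP : HasInvertibleProOrder R P)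
    (ρ : Representation R P V) (hρ : IsSmoothRep ρ) :
    ∃ e : V →ₗ[R] V, IsAveraging ρ e := by
  choose U hU using hρ
  have key : ∀ (U' : OpenSubgroup P) (v : V), (∀ u ∈ U', ρ u v = v) →
      orbitAverage ρ (U v) v = orbitAverage ρ U' v :=
    fun U' v h => orbitAverage_eq hP ρ h (hU v)
  let e : V →ₗ[R] V :=
    { toFun := fun v => orbitAverage ρ (U v) v
      map_add' := fun v w => by
        have h1 : ∀ u ∈ U v ⊓ U w, ρ u v = v := fun u hu => hU v u (OpenSubgroup.mem_inf.1 hu).1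
        have h2 : ∀ u ∈ U v ⊓ U w, ρ u w = w := fun u hu => hU w u (OpenSubgroup.mem_inf.1 hu).2
        have h3 : ∀ u ∈ U v ⊓ U w, ρ u (v + w) = v + w := fun u hu => by
          rw [map_add, h1 u hu, h2 u hu]
        rw [key _ _ h1, key _ _ h2, key _ _ h3]
        have := hP.finiteIndex (U v ⊓ U w)
        let := Fintype.ofFinite (P ⧸ (U v ⊓ U w).toSubgroup)
        simp only [orbitAverage, finsum_eq_sum_of_fintype, map_add, Finset.sum_add_distrib,
          smul_add]
      map_smul' := fun c v => by
        have h3 : ∀ u ∈ U v, ρ u (c • v) = c • v := fun u hu => by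
          rw [map_smul, hU v u hu]
        rw [key _ _ h3]
        have := hP.finiteIndex (U v)
        let := Fintype.ofFinite (P ⧸ (U v).toSubgroup)
        simp only [orbitAverage, finsum_eq_sum_of_fintype, map_smul, ← Finset.smul_sum,
          RingHom.id_apply]
        rw [smul_comm] }
  refine ⟨e, fun p v => ?_, fun p v => ?_, fun U' v hv => ?_⟩
  · change ρ p (orbitAverage ρ (U v) v) = orbitAverage ρ (U v) v
    have := hP.finiteIndex (U v)
    let := Fintype.ofFinite (P ⧸ (U v).toSubgroup)
    have h1 := finsum_quotient_translate (U := (U v).toSubgroup) (f := fun x => ρ x v)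
      (Representation.apply_mul_fixed ρ (hU v)) p
    unfold orbitAverage
    rw [map_smul]
    conv_rhs => rw [← h1]
    simp only [finsum_eq_sum_of_fintype, map_sum, map_mul, Module.End.mul_apply]
  · let U' : OpenSubgroup P := (U v).comap (MulAut.conj p⁻¹).toMonoidHom (by
      have hc : Continuous fun x : P => p⁻¹ * x * p⁻¹⁻¹ := by fun_prop
      exact hc)
    have hmem : ∀ u, u ∈ U'.toSubgroup ↔ p⁻¹ * u * p ∈ (U v).toSubgroup := fun u => by
      change p⁻¹ * u * p⁻¹⁻¹ ∈ (U v).toSubgroup ↔ _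
      rw [inv_inv]
    have h1 : ∀ u ∈ U', ρ u (ρ p v) = ρ p v := fun u hu => by
      have h2 := hU v _ ((hmem u).1 hu)
      conv_rhs => rw [← h2]
      rw [← Module.End.mul_apply, ← Module.End.mul_apply, ← map_mul, ← map_mul]
      congr 2; group
    change orbitAverage ρ (U (ρ p v)) (ρ p v) = orbitAverage ρ (U v) v
    rw [key _ _ h1]
    have h2 := finsum_quotient_mul_right (U := (U v).toSubgroup) (U' := U'.toSubgroup)
      (f := fun x => ρ x v) (Representation.apply_mul_fixed ρ (hU v)) p hmem
    have h3 : U'.toSubgroup.index = (U v).toSubgroup.index :=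
      Subgroup.index_comap_of_surjective _ (MulAut.conj p⁻¹).surjective
    unfold orbitAverage
    rw [h3, ← h2]
    simp only [map_mul, Module.End.mul_apply]
  · change _ • orbitAverage ρ (U v) v = _
    rw [key _ _ hv, orbitAverage, smul_smul, mul_inv_cancel₀ (hP.index_ne_zero U'), one_smul]

/-- `l` is constant on the orbit of `v`, so the averaging sum gives index times `l v`, and the index
is invertible. -/
theorem IsAveraging.apply_invariant (hP : HasInvertibleProOrder R P) {ρ : Representation R P V}
    (hρ : IsSmoothRep ρ) {e : V →ₗ[R] V} (he : IsAveraging ρ e) {W : Type*} [AddCommGroup W]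
    [Module R W] {l : V →ₗ[R] W} {v : V} (hl : ∀ p, l (ρ p v) = l v) : l (e v) = l v := by
  obtain ⟨U, hU⟩ := hρ v
  have := hP.finiteIndex U
  let := Fintype.ofFinite (P ⧸ U.toSubgroup)
  have h := congrArg l (he.index_smul U v hU)
  rw [map_smul, finsum_eq_sum_of_fintype, map_sum] at h
  simp only [hl, Finset.sum_const, Finset.card_univ] at h
  rw [← Nat.cast_smul_eq_nsmul R, ← Nat.card_eq_fintype_card] at h
  exact smul_right_injective W (hP.index_ne_zero U) h

theorem IsAveraging.apply_fixed (hP : HasInvertibleProOrder R P) {ρ : Representation R P V}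
    {e : V →ₗ[R] V} (he : IsAveraging ρ e) {v : V} (hv : ∀ p, ρ p v = v) : e v = v := by
  have := hP.finiteIndex ⊤
  let := Fintype.ofFinite (P ⧸ (⊤ : OpenSubgroup P).toSubgroup)
  have h := he.index_smul ⊤ v fun u _ => hv u
  simp only [finsum_eq_sum_of_fintype, hv, Finset.sum_const, Finset.card_univ] at h
  rw [← Nat.cast_smul_eq_nsmul R, ← Nat.card_eq_fintype_card] at h
  exact smul_right_injective V (hP.index_ne_zero ⊤) h

/-- Averaging a functional agrees with averaging the vector. -/
theorem IsAveraging.index_mul_apply (hP : HasInvertibleProOrder R P)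
    {ρ : Representation R P V} (hρ : IsSmoothRep ρ) {e : V →ₗ[R] V} (he : IsAveraging ρ e)
    (U : OpenSubgroup P) {l : Module.Dual R V} {v : V}
    (hl : ∀ u ∈ U, ∀ p, l (ρ (u * p) v) = l (ρ p v)) :
    (U.toSubgroup.index : R) * l (e v) = ∑ᶠ x : P ⧸ U.toSubgroup, l (ρ x.out⁻¹ v) := by
  have := hP.finiteIndex U
  let := Fintype.ofFinite (P ⧸ U.toSubgroup)
  let m : Module.Dual R V := ∑ x : P ⧸ U.toSubgroup, l ∘ₗ ρ x.out⁻¹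
  have hm : ∀ v, m v = ∑ᶠ x : P ⧸ U.toSubgroup, l (ρ x.out⁻¹ v) := fun v => by
    simp [m, finsum_eq_sum_of_fintype]
  -- Invariance of the summed functional at `v` allows replacing `v` by `e v`, on which all its
  -- summands agree.
  have hinv : ∀ p, m (ρ p v) = m v := fun p => by
    rw [hm, hm, ← finsum_quotient_translate (U := U.toSubgroup) (f := fun x => l (ρ x⁻¹ v))
      (fun x u hu => by
        rw [mul_inv_rev, hl _ (inv_mem hu)]) p⁻¹]
    refine finsum_congr fun x => ?_
    rw [mul_inv_rev, inv_inv, map_mul, Module.End.mul_apply]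
  rw [← hm, ← he.apply_invariant hP hρ hinv, hm]
  simp only [finsum_eq_sum_of_fintype, he.fixed, Finset.sum_const, Finset.card_univ]
  rw [← Nat.cast_smul_eq_nsmul R, ← Nat.card_eq_fintype_card]
  rfl

end Averaging

/-! ### The Haar integral of a matrix coefficient as an average. -/

section Haar

variable {R : Type*} [Field R] {Q : Type*} [Group Q]
  {V : Type*} [AddCommGroup V] [Module R V]

/-- Inversion exchanges `U \ Q` and `Q / U`. -/
theorem finsum_rightRel_eq {A : Type*} [AddCommMonoid A] {U : Subgroup Q} {F : Q → A}
    (hF : ∀ u ∈ U, ∀ x, F (u * x) = F x) :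
    ∑ᶠ x : Quotient (QuotientGroup.rightRel U), F x.out = ∑ᶠ x : Q ⧸ U, F x.out⁻¹ := by
  rw [← finsum_comp_equiv (QuotientGroup.quotientRightRelEquivQuotientLeftRel U)
    (f := fun x => F x.out⁻¹)]
  refine finsum_congr fun x => ?_
  induction x using Quotient.inductionOn with
  | h a =>
    have h1 : QuotientGroup.rightRel U (Quotient.out (Quotient.mk (QuotientGroup.rightRel U) a)) a :=
      Quotient.exact (Quotient.out_eq _)
    rw [QuotientGroup.rightRel_apply] at h1
    have h2 := apply_out_mk_of_rightInvariant (U := U) (f := fun x => F x⁻¹)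
      (fun x u hu => by rw [mul_inv_rev, hF _ (inv_mem hu)]) a⁻¹
    rw [inv_inv] at h2
    refine Eq.trans ?_ h2.symm
    rw [← hF _ h1, inv_mul_cancel_right]

theorem relIndex_inf_eq_of_out_mem {U K P : Subgroup Q}
    (hP : ∀ x : K ⧸ U.subgroupOf K, ((x.out : K) : Q) ∈ P) :
    U.relIndex (K ⊓ P) = U.relIndex K := by
  refine Nat.card_congr (Equiv.ofBijective
    (Subgroup.quotientSubgroupOfEmbeddingOfLE U (inf_le_left : K ⊓ P ≤ K))
    ⟨Function.Embedding.injective _, fun x => ?_⟩)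
  refine ⟨QuotientGroup.mk ⟨x.out, x.out.2, hP x⟩, ?_⟩
  rw [Subgroup.quotientSubgroupOfEmbeddingOfLE_apply_mk]
  exact QuotientGroup.out_eq' x

variable [TopologicalSpace Q]

theorem exists_finset_subset_mul [IsTopologicalGroup Q] {C : Set Q} (hC : IsCompact C)
    (U : OpenSubgroup Q) : ∃ T : Finset Q, C ⊆ (T : Set Q) * (U : Set Q) := by
  obtain ⟨t, ht⟩ := compact_covered_by_mul_left_translates (V := (U : Set Q)) hC
    (by rw [U.isOpen.interior_eq]; exact ⟨1, one_mem U⟩)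
  classical
  refine ⟨t.image (·⁻¹), fun x hx => ?_⟩
  obtain ⟨g, hg, hx⟩ := Set.mem_iUnion₂.1 (ht hx)
  exact ⟨g⁻¹, by simpa using hg, g * x, hx, by simp⟩

/-- The restriction of a representation to a subgroup. -/
abbrev Representation.res (ρ : Representation R Q V) (P : Subgroup Q) : Representation R P V :=
  ρ.comp P.subtype

/-- The intersection of an open subgroup with a subgroup. -/
def OpenSubgroup.restrict (U : OpenSubgroup Q) (P : Subgroup Q) : OpenSubgroup P :=
  U.comap P.subtype continuous_subtype_val

theorem IsSmoothRep.res {ρ : Representation R Q V} (hρ : IsSmoothRep ρ) (P : Subgroup Q) :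
    IsSmoothRep (ρ.res P) := fun v => by
  obtain ⟨U, hU⟩ := hρ v
  exact ⟨U.restrict P, fun u hu => hU u hu⟩

/-- The left-hand side does not mention `P`, so this compares the averages over two different
subgroups whose products with `M` contain the support. -/
theorem finsum_vector_eq {ρ : Representation R Q V} {P : Subgroup Q}
    (hP : HasInvertibleProOrder R P)
    {e : V →ₗ[R] V} (he : IsAveraging (ρ.res P) e) {M : OpenSubgroup Q} {v : V}
    (hM : ∀ m ∈ M, ρ m v = v) (l : Module.Dual R V)
    (hS : Function.support (fun q => l (ρ q v)) ⊆ (P : Set Q) * (M : Set Q)) :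
    ∑ᶠ x : Q ⧸ M.toSubgroup, l (ρ x.out v) = (M.toSubgroup.relIndex P : R) * l (e v) := by
  rw [finsum_quotient_eq_of_support_subset (U := M.toSubgroup) (f := fun q => l (ρ q v))
    (fun x u hu => by rw [Representation.apply_mul_fixed ρ hM x u hu]) P hS]
  have h := congrArg l (he.index_smul (M.restrict P) v fun u hu => hM u hu)
  have := hP.finiteIndex (M.restrict P)
  let := Fintype.ofFinite (P ⧸ (M.restrict P).toSubgroup)
  rw [map_smul, finsum_eq_sum_of_fintype, map_sum, ← finsum_eq_sum_of_fintype] at h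
  exact h.symm

/-- The integral of a matrix coefficient with compact support is computed by averaging over any
sufficiently large subgroup of invertible pro-order. -/
theorem haarIntegral_coeff_eq [IsTopologicalGroup Q] {ρ : Representation R Q V}
    (hρ : IsSmoothRep ρ) (K : OpenSubgroup Q) (hK : HasInvertibleProOrder R K)
    {l : Module.Dual R V} {U₀ : OpenSubgroup Q} (hl : ∀ u ∈ U₀, ∀ v, l (ρ u v) = l v) (v : V)
    {C : Set Q} (hC : IsCompact C) (hsupp : Function.support (fun q => l (ρ q v)) ⊆ C) :
    ∃ T : Finset Q, ∀ P : Subgroup Q, (T : Set Q) ⊆ P → HasInvertibleProOrder R P →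
      ∀ e, IsAveraging (ρ.res P) e →
        haarIntegral K (fun q => l (ρ q v)) = (K.toSubgroup.relIndex P : R) * l (e v) := by
  have h : ∃ U : OpenSubgroup Q, U ≤ K ∧
      ∀ u ∈ U, ∀ x, (fun q => l (ρ q v)) (u * x) = (fun q => l (ρ q v)) x :=
    ⟨K ⊓ U₀, inf_le_left, fun u hu x => by
      simp only [map_mul, Module.End.mul_apply]
      exact hl u (OpenSubgroup.mem_inf.1 hu).2 _⟩
  unfold haarIntegral
  rw [dif_pos h]
  obtain ⟨hUK, hU⟩ := h.choose_spec
  generalize h.choose = U at hUK hU ⊢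
  have hidx : (U.toSubgroup.relIndex K.toSubgroup : R) ≠ 0 := hK.index_ne_zero (U.restrict K)
  have := hK.finiteIndex (U.restrict K.toSubgroup)
  have : Finite (K.toSubgroup ⧸ U.toSubgroup.subgroupOf K.toSubgroup) :=
    Subgroup.finite_quotient_of_finiteIndex (H := (U.restrict K.toSubgroup).toSubgroup)
  change ∃ T : Finset Q, ∀ P : Subgroup Q, (T : Set Q) ⊆ P → HasInvertibleProOrder R P →
      ∀ e, IsAveraging (ρ.res P) e → (U.toSubgroup.relIndex K.toSubgroup : R)⁻¹ *
        ∑ᶠ x : Quotient (QuotientGroup.rightRel U.toSubgroup), l (ρ x.out v) = _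
  -- The inverse enters because the sum over `U \ Q` is rewritten below as a sum over `Q / U` of `q
  -- ↦ l (ρ q⁻¹ v)`.
  obtain ⟨T₁, hT₁⟩ := exists_finset_subset_mul hC.inv U
  -- Once `P` contains these representatives of `K / U`, `[P : P ∩ U] = [K : U] [P : P ∩ K]`, and
  -- the normalizing factor `[K : U]⁻¹` cancels the choice of `U`.
  let T₂ : Finset Q := (Set.finite_range
    fun x : K.toSubgroup ⧸ U.toSubgroup.subgroupOf K.toSubgroup => ((x.out : K.toSubgroup) : Q)).toFinset
  classical
  refine ⟨T₁ ∪ T₂, fun P hTP hP e he => ?_⟩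
  have hP₂ : U.toSubgroup.relIndex (K.toSubgroup ⊓ P) = U.toSubgroup.relIndex K.toSubgroup :=
    relIndex_inf_eq_of_out_mem fun x => hTP (by simp [T₂])
  have hP₃ : U.toSubgroup.relIndex P =
      U.toSubgroup.relIndex K.toSubgroup * K.toSubgroup.relIndex P := by
    rw [← hP₂, ← Subgroup.inf_relIndex_right U.toSubgroup (K.toSubgroup ⊓ P),
      ← Subgroup.inf_relIndex_right K.toSubgroup P,
      ← Subgroup.inf_relIndex_right U.toSubgroup P, ← inf_assoc,
      inf_eq_left.2 (show U.toSubgroup ≤ K.toSubgroup from hUK)]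
    exact (Subgroup.relIndex_mul_relIndex _ _ _ (inf_le_inf_right P hUK) inf_le_right).symm
  rw [finsum_rightRel_eq (U := U.toSubgroup) (F := fun q => l (ρ q v)) hU,
    finsum_quotient_eq_of_support_subset (U := U.toSubgroup) (f := fun q => l (ρ q⁻¹ v))
      (fun x u hu => by
        have := hU u⁻¹ (inv_mem hu) x⁻¹
        simpa only [mul_inv_rev] using this) P ?_]
  · have h2 := he.index_mul_apply hP (hρ.res P) (U.restrict P) (l := l) (v := v)
      (fun u hu p => hU u hu p)
    have h3 : ∑ᶠ x : P ⧸ U.toSubgroup.subgroupOf P, l (ρ ((x.out : P) : Q)⁻¹ v) =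
        (U.toSubgroup.relIndex P : R) * l (e v) := h2.symm
    rw [h3, hP₃, Nat.cast_mul, mul_assoc, inv_mul_cancel_left₀ hidx]
  · intro q hq
    obtain ⟨t, ht, u, hu, rfl⟩ := hT₁ (show q ∈ C⁻¹ from hsupp (show q⁻¹ ∈ _ from hq))
    exact ⟨t, hTP (by simp [Finset.mem_coe.1 ht]), u, hu, rfl⟩

end Haar

/-! ### Integrated functionals, and the vectors they kill. -/

section Functionals

variable {R : Type*} [Field R] {Q : Type*} [Group Q] [TopologicalSpace Q]
  {V : Type*} [AddCommGroup V] [Module R V]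

/-- The functionals that are invariant under an open subgroup and whose matrix coefficients all
have compact support. -/
def compactFunctionals (ρ : Representation R Q V) : Submodule R (Module.Dual R V) where
  carrier := {l | (∃ U : OpenSubgroup Q, ∀ u ∈ U, ∀ v, l (ρ u v) = l v) ∧
    ∀ v, ∃ C : Set Q, IsCompact C ∧ Function.support (fun q => l (ρ q v)) ⊆ C}
  add_mem' := by
    rintro a b ⟨⟨U, hU⟩, ha⟩ ⟨⟨U', hU'⟩, hb⟩
    refine ⟨⟨U ⊓ U', fun u hu v => ?_⟩, fun v => ?_⟩
    · obtain ⟨h1, h2⟩ := OpenSubgroup.mem_inf.1 hu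
      simp only [LinearMap.add_apply, hU u h1, hU' u h2]
    · obtain ⟨C, hC, hCa⟩ := ha v
      obtain ⟨C', hC', hCb⟩ := hb v
      exact ⟨C ∪ C', hC.union hC',
        (Function.support_add _ _).trans (Set.union_subset_union hCa hCb)⟩
  zero_mem' := ⟨⟨⊤, fun _ _ _ => rfl⟩, fun v => ⟨∅, isCompact_empty, by simp⟩⟩
  smul_mem' := by
    rintro c a ⟨⟨U, hU⟩, ha⟩
    refine ⟨⟨U, fun u hu v => ?_⟩, fun v => ?_⟩
    · simp only [LinearMap.smul_apply, hU u hu]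
    · obtain ⟨C, hC, hCa⟩ := ha v
      exact ⟨C, hC, (Function.support_const_smul_subset c _).trans hCa⟩

variable (R Q) in
/-- Each finite subset of `Q` lies in a subgroup of invertible pro-order. -/
def IsLocallyInvertible : Prop :=
  ∀ T : Finset Q, ∃ P : Subgroup Q, (T : Set Q) ⊆ P ∧ HasInvertibleProOrder R P

theorem HasInvertibleProOrder.relIndex_ne_zero {P : Subgroup Q}
    (hP : HasInvertibleProOrder R P) (K : OpenSubgroup Q) :
    (K.toSubgroup.relIndex P : R) ≠ 0 := hP.index_ne_zero (K.restrict P)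

variable [IsTopologicalGroup Q] {ρ : Representation R Q V}

theorem haarIntegral_eq_of_mem (hρ : IsSmoothRep ρ) (K : OpenSubgroup Q)
    (hK : HasInvertibleProOrder R K) {l : Module.Dual R V} (hl : l ∈ compactFunctionals ρ) (v : V) :
    ∃ T : Finset Q, ∀ P : Subgroup Q, (T : Set Q) ⊆ P → HasInvertibleProOrder R P →
      ∀ e, IsAveraging (ρ.res P) e →
        haarIntegral K (fun q => l (ρ q v)) = (K.toSubgroup.relIndex P : R) * l (e v) := by
  obtain ⟨⟨U, hU⟩, hC⟩ := hl
  obtain ⟨C, hC, hsupp⟩ := hC v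
  exact haarIntegral_coeff_eq hρ K hK hU v hC hsupp

/-- The functional `v ↦ ∫ l (ρ(q) v) dq`, as a linear function of `l`. -/
noncomputable def integratedFunctional (hρ : IsSmoothRep ρ) (hQ : IsLocallyInvertible R Q)
    (K : OpenSubgroup Q) (hK : HasInvertibleProOrder R K) :
    compactFunctionals ρ →ₗ[R] Module.Dual R V :=
  LinearMap.mk₂ R (fun (l : compactFunctionals ρ) v => haarIntegral K (fun q => l.1 (ρ q v)))
    (fun l l' v => by
      classical
      obtain ⟨T₁, h₁⟩ := haarIntegral_eq_of_mem hρ K hK l.2 v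
      obtain ⟨T₂, h₂⟩ := haarIntegral_eq_of_mem hρ K hK l'.2 v
      obtain ⟨T₃, h₃⟩ := haarIntegral_eq_of_mem hρ K hK (l + l').2 v
      obtain ⟨P, hT, hP⟩ := hQ (T₁ ∪ T₂ ∪ T₃)
      simp only [Finset.coe_union, Set.union_subset_iff] at hT
      obtain ⟨e, he⟩ := exists_averagingProjection hP _ (hρ.res P)
      rw [h₁ P hT.1.1 hP e he, h₂ P hT.1.2 hP e he, h₃ P hT.2 hP e he, ← mul_add]
      rfl)
    (fun c l v => by
      classical
      obtain ⟨T₁, h₁⟩ := haarIntegral_eq_of_mem hρ K hK l.2 v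
      obtain ⟨T₂, h₂⟩ := haarIntegral_eq_of_mem hρ K hK (c • l).2 v
      obtain ⟨P, hT, hP⟩ := hQ (T₁ ∪ T₂)
      simp only [Finset.coe_union, Set.union_subset_iff] at hT
      obtain ⟨e, he⟩ := exists_averagingProjection hP _ (hρ.res P)
      rw [h₁ P hT.1 hP e he, h₂ P hT.2 hP e he, smul_eq_mul, mul_left_comm]
      rfl)
    (fun l v w => by
      classical
      obtain ⟨T₁, h₁⟩ := haarIntegral_eq_of_mem hρ K hK l.2 v
      obtain ⟨T₂, h₂⟩ := haarIntegral_eq_of_mem hρ K hK l.2 w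
      obtain ⟨T₃, h₃⟩ := haarIntegral_eq_of_mem hρ K hK l.2 (v + w)
      obtain ⟨P, hT, hP⟩ := hQ (T₁ ∪ T₂ ∪ T₃)
      simp only [Finset.coe_union, Set.union_subset_iff] at hT
      obtain ⟨e, he⟩ := exists_averagingProjection hP _ (hρ.res P)
      rw [h₁ P hT.1.1 hP e he, h₂ P hT.1.2 hP e he, h₃ P hT.2 hP e he, ← mul_add, map_add, map_add])
    (fun c l v => by
      classical
      obtain ⟨T₁, h₁⟩ := haarIntegral_eq_of_mem hρ K hK l.2 v
      obtain ⟨T₂, h₂⟩ := haarIntegral_eq_of_mem hρ K hK l.2 (c • v)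
      obtain ⟨P, hT, hP⟩ := hQ (T₁ ∪ T₂)
      simp only [Finset.coe_union, Set.union_subset_iff] at hT
      obtain ⟨e, he⟩ := exists_averagingProjection hP _ (hρ.res P)
      rw [h₁ P hT.1 hP e he, h₂ P hT.2 hP e he, map_smul, map_smul, smul_eq_mul, smul_eq_mul,
        mul_left_comm])

theorem integratedFunctional_apply (hρ : IsSmoothRep ρ) (hQ : IsLocallyInvertible R Q)
    (K : OpenSubgroup Q) (hK : HasInvertibleProOrder R K) (l : compactFunctionals ρ) (v : V) :
    integratedFunctional hρ hQ K hK l v = haarIntegral K (fun q => l.1 (ρ q v)) := rfl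

/-- Compute both integrals with one `P` that also contains `q`: averaging over `P` does not see `ρ
q`. -/
theorem integratedFunctional_invariant (hρ : IsSmoothRep ρ) (hQ : IsLocallyInvertible R Q)
    (K : OpenSubgroup Q) (hK : HasInvertibleProOrder R K) (l : compactFunctionals ρ) (q : Q)
    (v : V) :
    integratedFunctional hρ hQ K hK l (ρ q v) = integratedFunctional hρ hQ K hK l v := by
  classical
  obtain ⟨T₁, h₁⟩ := haarIntegral_eq_of_mem hρ K hK l.2 v
  obtain ⟨T₂, h₂⟩ := haarIntegral_eq_of_mem hρ K hK l.2 (ρ q v)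
  obtain ⟨P, hT, hP⟩ := hQ (T₁ ∪ T₂ ∪ {q})
  simp only [Finset.coe_union, Set.union_subset_iff, Finset.coe_singleton,
    Set.singleton_subset_iff] at hT
  obtain ⟨e, he⟩ := exists_averagingProjection hP _ (hρ.res P)
  rw [integratedFunctional_apply, integratedFunctional_apply, h₁ P hT.1.1 hP e he,
    h₂ P hT.1.2 hP e he]
  have := he.invariant ⟨q, hT.2⟩ v
  exact congrArg (fun w => _ * l.1 w) this

/-- If the integrals of a family of matrix coefficients of `v` with uniformly bounded support
vanish, then some average of `v` is killed by the whole family. -/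
theorem exists_average_of_haarIntegral_eq_zero (hρ : IsSmoothRep ρ)
    (hQ : IsLocallyInvertible R Q) (K : OpenSubgroup Q) (hK : HasInvertibleProOrder R K)
    {ι : Type*} (l : ι → Module.Dual R V) (hl : ∀ i, l i ∈ compactFunctionals ρ) (v : V)
    {S : Set Q} (hS : IsCompact S)
    (hlS : ∀ i q q', l i (ρ q v) ≠ 0 → l i (ρ q' v) ≠ 0 → q⁻¹ * q' ∈ S)
    (h0 : ∀ i, haarIntegral K (fun q => l i (ρ q v)) = 0) :
    ∃ w : V, (∀ m : Module.Dual R V, (∀ q, m (ρ q v) = m v) → m w = m v) ∧ ∀ i, l i w = 0 := by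
  classical
  obtain ⟨M, hM⟩ := hρ v
  -- `P` depends only on `S` and the level `M` of `v`, hence is the same for every `i`.
  obtain ⟨T, hT⟩ := exists_finset_subset_mul hS M
  obtain ⟨P, hTP, hP⟩ := hQ T
  obtain ⟨e, he⟩ := exists_averagingProjection hP _ (hρ.res P)
  refine ⟨e v, fun m hm => he.apply_invariant hP (hρ.res P) (l := m) fun p => hm p, fun i => ?_⟩
  by_cases hz : ∃ p ∈ P, l i (ρ p v) ≠ 0
  · obtain ⟨p, hp, hpz⟩ := hz
    have hsupp : Function.support (fun q => l i (ρ q v)) ⊆ (P : Set Q) * (M : Set Q) := by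
      intro q hq
      obtain ⟨t, ht, m, hm, htm⟩ := hT (hlS i p q hpz hq)
      refine ⟨p * t, P.mul_mem hp (hTP ht), m, hm, ?_⟩
      change p * t * m = q
      change t * m = _ at htm
      rw [mul_assoc, htm, mul_inv_cancel_left]
    -- A larger `P'`, depending on `i`, turns the vanishing integral into `l i (e' v) = 0`. The sum
    -- over `Q / M`, a nonzero multiple of both `l i (e' v)` and `l i (e v)`, carries this back to
    -- `P`.
    obtain ⟨T₁, h₁⟩ := haarIntegral_eq_of_mem hρ K hK (hl i) v
    obtain ⟨C, hC, hCs⟩ := (hl i).2 v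
    obtain ⟨T₂, h₂⟩ := exists_finset_subset_mul hC M
    obtain ⟨P', hT', hP'⟩ := hQ (T₁ ∪ T₂)
    simp only [Finset.coe_union, Set.union_subset_iff] at hT'
    obtain ⟨e', he'⟩ := exists_averagingProjection hP' _ (hρ.res P')
    have h3 := h₁ P' hT'.1 hP' e' he'
    rw [h0 i, zero_eq_mul, or_iff_right (hP'.relIndex_ne_zero K)] at h3
    have h4 := finsum_vector_eq hP' he' hM (l i)
      ((hCs.trans h₂).trans (Set.mul_subset_mul_right hT'.2))
    rw [finsum_vector_eq hP he hM (l i) hsupp, h3, mul_zero, mul_eq_zero,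
      or_iff_right (hP.relIndex_ne_zero M)] at h4
    exact h4
  -- The support misses `P`, so every term of the average vanishes.
  · push Not at hz
    have h := congrArg (l i) (he.index_smul (M.restrict P) v fun u hu => hM u hu)
    have := hP.finiteIndex (M.restrict P)
    let := Fintype.ofFinite (P ⧸ (M.restrict P).toSubgroup)
    have hsum : ∑ x : P ⧸ (M.restrict P).toSubgroup, l i (ρ.res P x.out v) = 0 :=
      Finset.sum_eq_zero fun x _ => hz _ x.out.2
    rw [map_smul, finsum_eq_sum_of_fintype, map_sum, hsum, smul_eq_mul, mul_eq_zero,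
      or_iff_right (hP.index_ne_zero _)] at h
    exact h

end Functionals

/-! ### Permanence of invertible pro-order under subgroups and quotients. -/

section ProOrder

variable {R : Type*} [Field R] {G : Type*} [Group G] [TopologicalSpace G]

instance OpenSubgroup.isTopologicalGroup [IsTopologicalGroup G] (K : OpenSubgroup G) :
    IsTopologicalGroup K :=
  inferInstanceAs (IsTopologicalGroup K.toSubgroup)

theorem HasInvertibleProOrder.of_le {K K' : OpenSubgroup G}
    (hK : HasInvertibleProOrder R K) (h : K' ≤ K) : HasInvertibleProOrder R K' := fun U => by
  let W : OpenSubgroup G := ⟨U.toSubgroup.map K'.toSubgroup.subtype,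
    K'.isOpen.isOpenMap_subtype_val _ U.isOpen⟩
  have hW : W.toSubgroup ≤ K'.toSubgroup := Subgroup.map_subtype_le _
  have h1 : W.toSubgroup.relIndex K'.toSubgroup = U.toSubgroup.index := by
    change (W.toSubgroup.subgroupOf K'.toSubgroup).index = _
    rw [show W.toSubgroup.subgroupOf K'.toSubgroup = U.toSubgroup from
      Subgroup.comap_map_eq_self_of_injective (Subgroup.subtype_injective _) _]
  have h2 := hK.index_ne_zero (W.restrict K)
  have h3 : (W.restrict K).toSubgroup.index = U.toSubgroup.index *
      K'.toSubgroup.relIndex K.toSubgroup := by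
    rw [← h1]
    exact (Subgroup.relIndex_mul_relIndex _ _ _ hW h).symm
  rw [h3, Nat.cast_mul] at h2
  exact (left_ne_zero_of_mul h2).isUnit

theorem HasInvertibleProOrder.of_surjective {P P' : Type*} [Group P] [TopologicalSpace P]
    [Group P'] [TopologicalSpace P'] (hP : HasInvertibleProOrder R P) (f : P →* P')
    (hf : Continuous f) (hs : Function.Surjective f) : HasInvertibleProOrder R P' := fun U => by
  have := hP (U.comap f hf)
  rwa [show (U.comap f hf).toSubgroup.index = U.toSubgroup.index from
    Subgroup.index_comap_of_surjective _ hs] at this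

/-- The trace of a profinite group of invertible pro-order on a subgroup. -/
theorem HasInvertibleProOrder.subgroup {P : Type*} [Group P] [TopologicalSpace P]
    [IsTopologicalGroup P] [CompactSpace P] [TotallyDisconnectedSpace P]
    (hP : HasInvertibleProOrder R P) (H : Subgroup P) : HasInvertibleProOrder R H := fun U => by
  obtain ⟨W, hW, hWU⟩ := isOpen_induced_iff.1 U.isOpen
  have h1 : (1 : P) ∈ W := by
    have : (1 : H) ∈ Subtype.val ⁻¹' W := by rw [hWU]; exact one_mem U
    exact this
  obtain ⟨N, hN⟩ := ProfiniteGrp.exist_openNormalSubgroup_sub_open_nhds_of_one hW h1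
  have hle : N.toSubgroup.subgroupOf H ≤ U.toSubgroup := fun x hx => by
    have : x ∈ Subtype.val ⁻¹' W := hN hx
    rw [hWU] at this
    exact this
  have hnorm : N.toSubgroup.Normal := N.isNormal'
  -- Normality of `N` is what makes `[H : H ∩ N]` divide `[P : N]`.
  have hdvd : U.toSubgroup.index ∣ N.toSubgroup.index :=
    (Subgroup.index_dvd_of_le hle).trans (Subgroup.relIndex_dvd_index_of_normal _ H)
  obtain ⟨k, hk⟩ := hdvd
  have h2 := hP.index_ne_zero N.toOpenSubgroup
  change (N.toSubgroup.index : R) ≠ 0 at h2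
  rw [hk, Nat.cast_mul] at h2
  exact (left_ne_zero_of_mul h2).isUnit

/-- The image of an open subgroup in a quotient group. -/
def OpenSubgroup.quotientMap [IsTopologicalGroup G] (U : OpenSubgroup G) (Z : Subgroup G)
    [Z.Normal] : OpenSubgroup (G ⧸ Z) :=
  ⟨U.toSubgroup.map (QuotientGroup.mk' Z), QuotientGroup.isOpenMap_coe _ U.isOpen⟩

/-- The image of `K ∩ H` works: it is compact because `H` is closed, and invertibility passes from
`K` to `K ∩ H` and then to the image. -/
theorem exists_compactOpen_quotient [IsTopologicalGroup G] [TotallyDisconnectedSpace G]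
    (hG : ∃ K : OpenSubgroup G, IsCompact (K : Set G) ∧ HasInvertibleProOrder R K)
    (H : Subgroup G) (hH : IsClosed (H : Set G)) (Z : Subgroup H) [Z.Normal] :
    ∃ K : OpenSubgroup (H ⧸ Z), IsCompact (K : Set (H ⧸ Z)) ∧ HasInvertibleProOrder R K := by
  obtain ⟨K, hKc, hK⟩ := hG
  refine ⟨(K.restrict H).quotientMap Z, ?_, ?_⟩
  · have h1 : IsCompact ((K.restrict H : OpenSubgroup H) : Set H) :=
      hH.isClosedEmbedding_subtypeVal.isCompact_preimage hKc
    exact h1.image QuotientGroup.continuous_mk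
  · have : CompactSpace K := isCompact_iff_compactSpace.1 hKc
    have h1 := hK.subgroup (H.subgroupOf K.toSubgroup)
    let f : H.subgroupOf K.toSubgroup →* H ⧸ Z :=
      (QuotientGroup.mk' Z).comp
        { toFun := fun x => ⟨(x : K), x.2⟩
          map_one' := rfl
          map_mul' := fun _ _ => rfl }
    have hf : Continuous f := QuotientGroup.continuous_mk.comp
      ((continuous_subtype_val.comp continuous_subtype_val).subtype_mk _)
    have hr : ∀ x, f x ∈ ((K.restrict H).quotientMap Z).toSubgroup := fun x =>
      ⟨⟨(x : K), x.2⟩, (x : K).2, rfl⟩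
    refine h1.of_surjective (f.codRestrict _ hr) (hf.subtype_mk _) ?_
    rintro ⟨_, h, hh, rfl⟩
    exact ⟨⟨⟨h, hh⟩, h.2⟩, rfl⟩

end ProOrder

/-! ### Contragredient, irreducibility and the central character. -/

section Irreducible

variable {R : Type*} [Field R] {G : Type*} [Group G]
  {V : Type*} [AddCommGroup V] [Module R V] {π : Representation R G V}

theorem Representation.IsIrreducible.eq_bot_or_eq_top_of_stable (hirr : π.IsIrreducible)
    (W : Submodule R V) (hW : ∀ g, ∀ v ∈ W, π g v ∈ W) : W = ⊥ ∨ W = ⊤ := by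
  rcases hirr.eq_bot_or_eq_top ⟨W, fun g v hv => hW g v hv⟩ with h | h
  · exact Or.inl (congrArg Subrepresentation.toSubmodule h)
  · exact Or.inr (congrArg Subrepresentation.toSubmodule h)

theorem Representation.IsIrreducible.nontrivial_space (hirr : π.IsIrreducible) :
    Nontrivial V := by
  by_contra h
  rw [not_nontrivial_iff_subsingleton] at h
  refine hirr.bot_ne_top (Subrepresentation.toSubmodule_injective ?_)
  exact Subsingleton.elim _ _

theorem centralCharacter_spec (h : ∃ ω : Subgroup.center G →* Rˣ,
    ∀ (z : Subgroup.center G) (v : V), π (z : G) v = (ω z : R) • v)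
    (z : Subgroup.center G) (v : V) : π (z : G) v = (centralCharacter π z : R) • v := by
  unfold centralCharacter
  rw [dif_pos h]
  exact h.choose_spec z v

variable [TopologicalSpace G]

theorem mem_contragredient_iff {l : Module.Dual R V} :
    l ∈ contragredient π ↔ ∃ U : OpenSubgroup G, ∀ u ∈ U, ∀ v, l (π u v) = l v := by
  constructor
  · rintro ⟨U, hU⟩
    refine ⟨U, fun u hu v => ?_⟩
    have := LinearMap.congr_fun (hU u⁻¹ (inv_mem hu)) v
    rwa [Representation.dual_apply, inv_inv] at this
  · rintro ⟨U, hU⟩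
    refine ⟨U, fun u hu => LinearMap.ext fun v => ?_⟩
    rw [Representation.dual_apply]
    exact hU _ (inv_mem hu) v

theorem comp_mem_contragredient [IsTopologicalGroup G] {l : Module.Dual R V}
    (hl : l ∈ contragredient π) (g : G) : l ∘ₗ π g ∈ contragredient π := by
  obtain ⟨U, hU⟩ := mem_contragredient_iff.1 hl
  refine mem_contragredient_iff.2 ⟨U.comap (MulAut.conj g).toMonoidHom (by
    have hc : Continuous fun x : G => g * x * g⁻¹ := by fun_prop
    exact hc), fun u hu v => ?_⟩
  have h1 := hU (g * u * g⁻¹) hu (π g v)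
  rwa [← Module.End.mul_apply, ← map_mul, inv_mul_cancel_right, map_mul] at h1

theorem exists_small_fixing [IsTopologicalGroup G]
    (hG : ∃ K : OpenSubgroup G, IsCompact (K : Set G) ∧ HasInvertibleProOrder R K)
    (hsmooth : IsSmoothRep π) (v : V) :
    ∃ K : OpenSubgroup G, IsCompact (K : Set G) ∧ HasInvertibleProOrder R K ∧
      ∀ k ∈ K, π k v = v := by
  obtain ⟨K, hKc, hK⟩ := hG
  obtain ⟨U, hU⟩ := hsmooth v
  exact ⟨K ⊓ U, hKc.of_isClosed_subset (K ⊓ U).isClosed (fun x hx => hx.1),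
    hK.of_le inf_le_left, fun k hk => hU k (OpenSubgroup.mem_inf.1 hk).2⟩

/-- Composing any form nonzero at `v` with averaging over a compact open subgroup fixing `v` makes
it smooth and keeps its value at `v`. -/
theorem exists_contragredient_apply_ne_zero [IsTopologicalGroup G]
    (hG : ∃ K : OpenSubgroup G, IsCompact (K : Set G) ∧ HasInvertibleProOrder R K)
    (hsmooth : IsSmoothRep π) {v : V} (hv : v ≠ 0) : ∃ l ∈ contragredient π, l v ≠ 0 := by
  obtain ⟨K, -, hK, hKv⟩ := exists_small_fixing hG hsmooth v
  obtain ⟨e, he⟩ := exists_averagingProjection hK (π.res K.toSubgroup) (hsmooth.res _)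
  obtain ⟨l, hl⟩ : ∃ l : Module.Dual R V, l v ≠ 0 := by
    by_contra! h
    exact hv ((Module.forall_dual_apply_eq_zero_iff R v).1 h)
  refine ⟨l ∘ₗ e, mem_contragredient_iff.2 ⟨K, fun u hu w => ?_⟩, ?_⟩
  · exact congrArg l (he.invariant ⟨u, hu⟩ w)
  · rwa [LinearMap.comp_apply, he.apply_fixed hK fun p => hKv p p.2]

/-- Schur's lemma for the center. -/
theorem exists_centralCharacter [IsAlgClosed R] [IsTopologicalGroup G]
    (hG : ∃ K : OpenSubgroup G, IsCompact (K : Set G) ∧ HasInvertibleProOrder R K)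
    (hsmooth : IsSmoothRep π) (hirr : π.IsIrreducible) (hadm : IsAdmissibleRep π) :
    ∃ ω : Subgroup.center G →* Rˣ, ∀ (z : Subgroup.center G) (v : V),
      π (z : G) v = (ω z : R) • v := by
  have := hirr.nontrivial_space
  obtain ⟨v₀, hv₀⟩ := exists_ne (0 : V)
  obtain ⟨K, hKc, -, hKv⟩ := exists_small_fixing hG hsmooth v₀
  have := hadm K hKc
  have : Nontrivial (fixedVectors π K.toSubgroup) :=
    ⟨⟨v₀, hKv⟩, 0, fun h => hv₀ (congrArg Subtype.val h)⟩
  have hcomm : ∀ (z : Subgroup.center G) (g : G) (v : V), π g (π z v) = π z (π g v) := by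
    intro z g v
    rw [← Module.End.mul_apply, ← Module.End.mul_apply, ← map_mul, ← map_mul,
      Subgroup.mem_center_iff.1 z.2 g]
  have hc : ∀ z : Subgroup.center G, ∃ c : R, ∀ v, π z v = c • v := by
    intro z
    -- Admissibility makes these fixed vectors finite-dimensional, so `z` has an eigenvector; its
    -- eigenspace in `V` is `G`-stable.
    let f : Module.End R (fixedVectors π K.toSubgroup) :=
      (π z).restrict fun v hv k hk => by rw [hcomm, hv k hk]
    obtain ⟨c, hc⟩ := Module.End.exists_eigenvalue f
    obtain ⟨w, hw⟩ := hc.exists_hasEigenvector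
    refine ⟨c, fun v => ?_⟩
    rcases hirr.eq_bot_or_eq_top_of_stable (LinearMap.ker (π z - c • LinearMap.id))
      (fun g v hv => by
        rw [LinearMap.mem_ker, LinearMap.sub_apply, LinearMap.smul_apply, LinearMap.id_apply,
          sub_eq_zero] at hv ⊢
        rw [← hcomm, hv, map_smul]) with h | h
    · refine absurd (Subtype.ext ?_) hw.2
      have h1 : (w : V) ∈ LinearMap.ker (π z - c • LinearMap.id) := by
        rw [LinearMap.mem_ker, LinearMap.sub_apply, sub_eq_zero]
        exact congrArg Subtype.val hw.apply_eq_smul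
      rw [h] at h1
      exact h1
    · have h1 : v ∈ LinearMap.ker (π z - c • LinearMap.id) := h ▸ Submodule.mem_top
      rwa [LinearMap.mem_ker, LinearMap.sub_apply, sub_eq_zero] at h1
  choose c hc using hc
  have hinj : ∀ {a b : R}, a • v₀ = b • v₀ → a = b := fun h => smul_left_injective R hv₀ h
  let f : Subgroup.center G →* R :=
    { toFun := c
      map_one' := hinj (by rw [← hc, one_smul, OneMemClass.coe_one, map_one]; rfl)
      map_mul' := fun a b => hinj (by
        rw [← hc, Subgroup.coe_mul, map_mul, Module.End.mul_apply, hc, hc, smul_smul,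
          mul_comm]) }
  exact ⟨f.toHomUnits, fun z v => hc z v⟩

end Irreducible

/-! ### The twisted representation of `Z \ Z N` and its periods. -/

section CenterQuotientRep

variable {R : Type*} [Field R] {G : Type*} [Group G]
  {V : Type*} [AddCommGroup V] [Module R V]

/-- The representation `χ⁻¹ π` of `Z N` on `V`, viewed as a representation of `Z \ Z N`, for a
character `χ` of `Z N` through which `Z` acts. -/
noncomputable def centerQuotientRep (π : Representation R G V) {N : Subgroup G}
    (χ : ↥(Subgroup.center G ⊔ N) →* Rˣ)
    (hχ : ∀ h : ↥(Subgroup.center G ⊔ N), (h : G) ∈ Subgroup.center G →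
      ∀ v, π h v = (χ h : R) • v) : Representation R (CenterQuotient N) V :=
  QuotientGroup.lift _
    { toFun := fun h => (((χ h)⁻¹ : Rˣ) : R) • π h
      map_one' := by simp
      map_mul' := fun a b => by
        rw [map_mul, mul_inv, Units.val_mul, Subgroup.coe_mul, map_mul, smul_mul_smul_comm] }
    (fun h hh => by
      rw [MonoidHom.mem_ker]
      refine LinearMap.ext fun v => ?_
      change (((χ h)⁻¹ : Rˣ) : R) • π h v = v
      rw [hχ h hh, smul_smul, Units.inv_mul, one_smul])

variable {π : Representation R G V} {N : Subgroup G} {χ : ↥(Subgroup.center G ⊔ N) →* Rˣ}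
  {hχ : ∀ h : ↥(Subgroup.center G ⊔ N), (h : G) ∈ Subgroup.center G →
      ∀ v, π h v = (χ h : R) • v}

theorem centerQuotientRep_mk (h : ↥(Subgroup.center G ⊔ N)) (v : V) :
    centerQuotientRep π χ hχ (QuotientGroup.mk h) v = (((χ h)⁻¹ : Rˣ) : R) • π h v := rfl

theorem periodIntegrand_eq_coeff (vd : Module.Dual R V) (v : V) :
    periodIntegrand π χ vd v = fun q => vd (centerQuotientRep π χ hχ q v) := by
  funext q
  conv_rhs => rw [← QuotientGroup.out_eq' q, centerQuotientRep_mk, map_smul]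
  rfl

theorem apply_centerQuotientRep_ne_zero_iff {l : Module.Dual R V}
    {h : ↥(Subgroup.center G ⊔ N)} {v : V} :
    l (centerQuotientRep π χ hχ (QuotientGroup.mk h) v) ≠ 0 ↔ l (π h v) ≠ 0 := by
  rw [centerQuotientRep_mk, map_smul, smul_eq_mul, mul_ne_zero_iff,
    and_iff_right (Units.ne_zero _)]

/-- At `z n` the factor `ω(z)` cancels, so the twisted action is seen by `l` as `θ(n)⁻¹ l(π(n) v)`.
-/
theorem mem_whittakerSpace_iff {θ : N →* Rˣ} {ω : Subgroup.center G →* Rˣ}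
    (hω : ∀ (z : Subgroup.center G) (v : V), π (z : G) v = (ω z : R) • v)
    (hagree : ∀ (g : G) (hz : g ∈ Subgroup.center G) (hn : g ∈ N), ω ⟨g, hz⟩ = θ ⟨g, hn⟩)
    (hχ : ∀ h : ↥(Subgroup.center G ⊔ N), (h : G) ∈ Subgroup.center G →
      ∀ v, π h v = (centralMulChar ω θ hagree h : R) • v) {l : Module.Dual R V} :
    l ∈ whittakerSpace π θ ↔
      ∀ q v, l (centerQuotientRep π (centralMulChar ω θ hagree) hχ q v) = l v := by
  have key : ∀ (z : Subgroup.center G) (n : N) (h : ↥(Subgroup.center G ⊔ N)) (v : V),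
      (z : G) * n = h → l (centerQuotientRep π (centralMulChar ω θ hagree) hχ
        (QuotientGroup.mk h) v) = (((θ n)⁻¹ : Rˣ) : R) * l (π n v) := by
    intro z n h v e
    rw [centerQuotientRep_mk, centralMulChar_apply ω θ hagree h z n e, ← e, map_mul,
      Module.End.mul_apply, hω, smul_smul, map_smul, smul_eq_mul, mul_inv_rev, Units.val_mul,
      mul_assoc, mul_assoc, Units.inv_mul_cancel_left]
  constructor
  · intro hl q v
    induction q using QuotientGroup.induction_on with
    | H h =>
      obtain ⟨⟨z, n⟩, e⟩ := exists_center_mul h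
      rw [key z n h v e, hl n v, Units.inv_mul_cancel_left]
  · intro hl n v
    have h1 := key 1 n ⟨n, le_sup_right (a := Subgroup.center G) n.2⟩ v (one_mul _)
    rw [hl] at h1
    rw [h1, Units.mul_inv_cancel_left]

theorem mk_mem_image_of_mem_center_mul {C : Set G} {h : ↥(Subgroup.center G ⊔ N)}
    (hh : (h : G) ∈ (Subgroup.center G : Set G) * C) :
    (QuotientGroup.mk h : CenterQuotient N) ∈
      (QuotientGroup.mk : _ → CenterQuotient N) '' (Subtype.val ⁻¹' C) := by
  obtain ⟨z, hz, c, hc, e⟩ := hh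
  have hzH : z ∈ Subgroup.center G ⊔ N := Subgroup.mem_sup_left hz
  have e1 : z * c = h := e
  have ec : z⁻¹ * h = c := by rw [← e1, inv_mul_cancel_left]
  refine ⟨(⟨z, hzH⟩ : ↥(Subgroup.center G ⊔ N))⁻¹ * h, ?_, ?_⟩
  · change z⁻¹ * (h : G) ∈ C
    rwa [ec]
  · rw [QuotientGroup.eq, Subgroup.mem_subgroupOf]
    have : (((⟨z, hzH⟩ : ↥(Subgroup.center G ⊔ N))⁻¹ * h)⁻¹ * h :
        ↥(Subgroup.center G ⊔ N)) = z := by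
      have hcz := Subgroup.mem_center_iff.1 hz (h : G)⁻¹
      simp only [mul_inv_rev, inv_inv, Subgroup.coe_mul, Subgroup.coe_inv]
      rw [hcz, inv_mul_cancel_right]
    rw [this]
    exact hz

variable [TopologicalSpace G]

theorem isCompact_image_centerQuotient
    (hZN : IsClosed ((Subgroup.center G ⊔ N : Subgroup G) : Set G)) {C : Set G}
    (hC : IsCompact C) :
    IsCompact ((QuotientGroup.mk : _ → CenterQuotient N) '' (Subtype.val ⁻¹' C)) :=
  (hZN.isClosedEmbedding_subtypeVal.isCompact_preimage hC).image QuotientGroup.continuous_mk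

/-- `N → Z \ Z N` is onto: lift the finite set to `N`, enclose it in a compact subgroup, and push
that forward. -/
theorem isLocallyInvertible_centerQuotient (hN : IsExhaustedByCompacts R N) :
    IsLocallyInvertible R (CenterQuotient N) := fun T => by
  classical
  let f : N →* CenterQuotient N :=
    (QuotientGroup.mk' _).comp (Subgroup.inclusion (le_sup_right (a := Subgroup.center G)))
  have hf : Continuous f := QuotientGroup.continuous_mk.comp
    (continuous_subtype_val.subtype_mk _)
  have hs : Function.Surjective f := by
    intro q
    induction q using QuotientGroup.induction_on with
    | H h =>
      obtain ⟨⟨z, n⟩, e⟩ := exists_center_mul h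
      refine ⟨n, ?_⟩
      change (QuotientGroup.mk _ : CenterQuotient N) = QuotientGroup.mk h
      rw [QuotientGroup.eq, Subgroup.mem_subgroupOf]
      change (n : G)⁻¹ * (h : G) ∈ Subgroup.center G
      rw [← e, ← mul_assoc, Subgroup.mem_center_iff.1 z.2, inv_mul_cancel_right]
      exact z.2
  obtain ⟨P, -, hP, hTP⟩ := hN (Function.surjInv hs '' T) (T.finite_toSet.image _).isCompact
  refine ⟨P.map f, fun t ht => ⟨Function.surjInv hs t, hTP ⟨t, ht, rfl⟩,
    Function.surjInv_eq hs t⟩, hP.of_surjective (f.subgroupMap P) ?_ (f.subgroupMap_surjective P)⟩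
  exact (hf.comp continuous_subtype_val).subtype_mk _

theorem haarIntegral_eq_zero {Q : Type*} [Group Q] [TopologicalSpace Q] (K : OpenSubgroup Q)
    {F : Q → R} (hF : ∀ q, F q = 0) : haarIntegral K F = 0 := by
  unfold haarIntegral
  split_ifs
  · simp [hF]
  · rfl

/-- For a Whittaker period `W` the function `g ↦ W (π(g) v)` has compact support modulo `Z N`. -/
theorem hasCompactSupportMod_whittakerPeriod (hZ : IsZCompact π)
    (K : OpenSubgroup (CenterQuotient N)) {vd : Module.Dual R V} (hvd : vd ∈ contragredient π)
    (v : V) : HasCompactSupportMod (Subgroup.center G ⊔ N)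
      (fun g => whittakerPeriod π χ K vd (π g v)) := by
  obtain ⟨C, hC, hsupp⟩ := hZ vd hvd v
  refine ⟨C, hC, fun g hg => ?_⟩
  obtain ⟨q, hq⟩ : ∃ q, periodIntegrand π χ vd (π g v) q ≠ 0 := by
    by_contra! h
    exact hg (haarIntegral_eq_zero K h)
  have h1 := right_ne_zero_of_mul hq
  rw [matrixCoeff, ← Module.End.mul_apply, ← map_mul] at h1
  obtain ⟨z, hz, c, hc, e⟩ := hsupp h1
  refine ⟨((q.out : ↥(Subgroup.center G ⊔ N)) : G)⁻¹ * z,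
    mul_mem (inv_mem (SetLike.coe_mem _)) (Subgroup.mem_sup_left hz), c, hc, ?_⟩
  change z * c = _ at e
  change _ * z * c = g
  rw [mul_assoc, e, inv_mul_cancel_left]

variable [IsTopologicalGroup G]

theorem centerQuotientRep_smooth (hsmooth : IsSmoothRep π) (hs : IsSmoothChar χ) :
    IsSmoothRep (centerQuotientRep π χ hχ) := fun v => by
  obtain ⟨U, hU⟩ := hsmooth v
  obtain ⟨U', hU'⟩ := hs
  refine ⟨(U.restrict _ ⊓ U').quotientMap _, ?_⟩
  rintro _ ⟨h, hh, rfl⟩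
  obtain ⟨h1, h2⟩ := OpenSubgroup.mem_inf.1 hh
  change centerQuotientRep π χ hχ (QuotientGroup.mk h) v = v
  rw [centerQuotientRep_mk, hU' h h2, hU h h1, inv_one, Units.val_one, one_smul]

theorem exists_openSubgroup_coeff_invariant (hs : IsSmoothChar χ) {l : Module.Dual R V}
    (hl : l ∈ contragredient π) : ∃ U : OpenSubgroup (CenterQuotient N),
      ∀ u ∈ U, ∀ v, l (centerQuotientRep π χ hχ u v) = l v := by
  obtain ⟨U, hU⟩ := mem_contragredient_iff.1 hl
  obtain ⟨U', hU'⟩ := hs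
  refine ⟨(U.restrict _ ⊓ U').quotientMap _, ?_⟩
  rintro _ ⟨h, hh, rfl⟩ v
  obtain ⟨h1, h2⟩ := OpenSubgroup.mem_inf.1 hh
  change l (centerQuotientRep π χ hχ (QuotientGroup.mk h) v) = _
  rw [centerQuotientRep_mk, hU' h h2, inv_one, Units.val_one, one_smul, hU h h1]

theorem contragredient_le_compactFunctionals (hs : IsSmoothChar χ) (hZ : IsZCompact π)
    (hZN : IsClosed ((Subgroup.center G ⊔ N : Subgroup G) : Set G)) :
    contragredient π ≤ compactFunctionals (centerQuotientRep π χ hχ) := fun l hl => by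
  refine ⟨exists_openSubgroup_coeff_invariant hs hl, fun v => ?_⟩
  obtain ⟨C, hC, hsupp⟩ := hZ l hl v
  refine ⟨_, isCompact_image_centerQuotient hZN hC, fun q hq => ?_⟩
  induction q using QuotientGroup.induction_on with
  | H h =>
    exact mk_mem_image_of_mem_center_mul
      (hsupp (apply_centerQuotientRep_ne_zero_iff.1 (Function.mem_support.1 hq)))

/-- A vector at which all Whittaker periods vanish is killed by all invariant functionals. -/
theorem apply_eq_zero_of_haarIntegral_eq_zero
    (hG : ∃ K : OpenSubgroup G, IsCompact (K : Set G) ∧ HasInvertibleProOrder R K)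
    (hN : IsExhaustedByCompacts R N) (hsmooth : IsSmoothRep π) (hirr : π.IsIrreducible)
    (hs : IsSmoothChar χ) (hZ : IsZCompact π)
    (hZN : IsClosed ((Subgroup.center G ⊔ N : Subgroup G) : Set G))
    (K : OpenSubgroup (CenterQuotient N)) (hK : HasInvertibleProOrder R K) {v : V}
    (h0 : ∀ vd ∈ contragredient π,
      haarIntegral K (fun q => vd (centerQuotientRep π χ hχ q v)) = 0)
    {m : Module.Dual R V} (hm : ∀ q v, m (centerQuotientRep π χ hχ q v) = m v) : m v = 0 := by
  have := hirr.nontrivial_space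
  obtain ⟨v₀, hv₀⟩ := exists_ne (0 : V)
  obtain ⟨l, hl, hlv₀⟩ := exists_contragredient_apply_ne_zero hG hsmooth hv₀
  obtain ⟨C, hC, hsupp⟩ := hZ l hl v
  -- If `g h ∈ Z C` and `g h' ∈ Z C`, then `h⁻¹ h' ∈ Z C⁻¹ C`: `g` cancels, so the bound on the
  -- supports is uniform in `g`.
  obtain ⟨w, hw, hlw⟩ := exists_average_of_haarIntegral_eq_zero
    (centerQuotientRep_smooth (hχ := hχ) hsmooth hs)
    (isLocallyInvertible_centerQuotient hN) K hK (fun g : G => l ∘ₗ π g)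
    (fun g => contragredient_le_compactFunctionals hs hZ hZN (comp_mem_contragredient hl g)) v
    (isCompact_image_centerQuotient hZN (hC.inv.mul hC)) (fun g q q' hq hq' => by
      induction q using QuotientGroup.induction_on with
      | H h =>
        induction q' using QuotientGroup.induction_on with
        | H h' =>
          rw [apply_centerQuotientRep_ne_zero_iff] at hq hq'
          rw [← QuotientGroup.mk_inv, ← QuotientGroup.mk_mul]
          apply mk_mem_image_of_mem_center_mul
          rw [LinearMap.comp_apply, ← Module.End.mul_apply, ← map_mul] at hq hq'
          obtain ⟨z, hz, c, hc, e⟩ := hsupp hq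
          obtain ⟨z', hz', c', hc', e'⟩ := hsupp hq'
          refine ⟨z⁻¹ * z', mul_mem (inv_mem hz) hz', c⁻¹ * c',
            Set.mul_mem_mul (Set.inv_mem_inv.2 hc) hc', ?_⟩
          change z * c = g * h at e
          change z' * c' = g * h' at e'
          have e1 : (h : G)⁻¹ * h' = (g * h)⁻¹ * (g * h') := by group
          have hcz := Subgroup.mem_center_iff.1 (mul_mem (inv_mem hz) hz') c⁻¹
          change z⁻¹ * z' * (c⁻¹ * c') = (h : G)⁻¹ * h'
          rw [e1, ← e, ← e', ← mul_assoc, ← hcz]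
          group)
    (fun g => h0 _ (comp_mem_contragredient hl g))
  rw [← hw m fun q => hm q v]
  -- The common kernel of the translates of `l` is `G`-stable and omits `v₀`, so it is zero.
  let W : Submodule R V :=
    { carrier := {x | ∀ g, l (π g x) = 0}
      add_mem' := fun {a b} ha hb g => by rw [map_add, map_add, ha g, hb g, add_zero]
      zero_mem' := fun g => by rw [map_zero, map_zero]
      smul_mem' := fun c x hx g => by rw [map_smul, map_smul, hx g, smul_zero] }
  rcases hirr.eq_bot_or_eq_top_of_stable W (fun g x hx g' => by
    rw [← Module.End.mul_apply, ← map_mul]; exact hx _) with h | h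
  · have h1 : w ∈ W := hlw
    rw [h, Submodule.mem_bot] at h1
    rw [h1, map_zero]
  · have h1 : v₀ ∈ W := h ▸ Submodule.mem_top
    have h2 := h1 1
    rw [map_one] at h2
    exact absurd h2 hlv₀

/-- Whittaker periods exhaust the invariant functionals. -/
theorem setOf_whittakerSpace_eq_periods
    (hG : ∃ K : OpenSubgroup G, IsCompact (K : Set G) ∧ HasInvertibleProOrder R K)
    (hN : IsExhaustedByCompacts R N) (hsmooth : IsSmoothRep π) (hirr : π.IsIrreducible)
    (hZ : IsZCompact π) (hZN : IsClosed ((Subgroup.center G ⊔ N : Subgroup G) : Set G))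
    {θ : N →* Rˣ} {ω : Subgroup.center G →* Rˣ}
    (hω : ∀ (z : Subgroup.center G) (v : V), π (z : G) v = (ω z : R) • v)
    (hagree : ∀ (g : G) (hz : g ∈ Subgroup.center G) (hn : g ∈ N), ω ⟨g, hz⟩ = θ ⟨g, hn⟩)
    (hχ : ∀ h : ↥(Subgroup.center G ⊔ N), (h : G) ∈ Subgroup.center G →
      ∀ v, π h v = (centralMulChar ω θ hagree h : R) • v)
    (hs : IsSmoothChar (centralMulChar ω θ hagree))
    (hfin : FiniteDimensional R (whittakerSpace π θ))
    (K : OpenSubgroup (CenterQuotient N)) (hK : HasInvertibleProOrder R K) :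
    {f : V → R | ∃ L ∈ whittakerSpace π θ, f = L} =
      {f : V → R | ∃ vd ∈ contragredient π,
        f = whittakerPeriod π (centralMulChar ω θ hagree) K vd} := by
  have hρ := centerQuotientRep_smooth (hχ := hχ) hsmooth hs
  have hQ := isLocallyInvertible_centerQuotient (R := R) hN
  have hle := contragredient_le_compactFunctionals (hχ := hχ) hs hZ hZN
  let J := integratedFunctional hρ hQ K hK ∘ₗ Submodule.inclusion hle
  have hJ : ∀ vd : contragredient π, (J vd : V → R) =
      whittakerPeriod π (centralMulChar ω θ hagree) K vd := fun vd => funext fun v => by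
    unfold whittakerPeriod
    rw [periodIntegrand_eq_coeff (hχ := hχ)]
    rfl
  have hJW : LinearMap.range J ≤ whittakerSpace π θ := by
    rintro _ ⟨vd, rfl⟩
    exact (mem_whittakerSpace_iff hω hagree hχ).2 fun q v =>
      integratedFunctional_invariant hρ hQ K hK _ q v
  have : FiniteDimensional R (LinearMap.range J) := Submodule.finiteDimensional_of_le hJW
  have hWJ : whittakerSpace π θ ≤ LinearMap.range J := by
    intro m hm
    -- Being finite-dimensional, the space of periods is the annihilator of its common kernel.
    rw [← Subspace.dualCoannihilator_dualAnnihilator_eq (W := LinearMap.range J),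
      Submodule.mem_dualAnnihilator]
    intro v hv
    rw [Submodule.mem_dualCoannihilator] at hv
    exact apply_eq_zero_of_haarIntegral_eq_zero hG hN hsmooth hirr hs hZ hZN K hK
      (fun vd hvd => hv _ ⟨⟨vd, hvd⟩, rfl⟩) ((mem_whittakerSpace_iff hω hagree hχ).1 hm)
  ext f
  constructor
  · rintro ⟨L, hL, rfl⟩
    obtain ⟨vd, rfl⟩ := hWJ hL
    exact ⟨vd, vd.2, hJ vd⟩
  · rintro ⟨vd, hvd, rfl⟩
    exact ⟨_, hJW ⟨⟨vd, hvd⟩, rfl⟩, (hJ ⟨vd, hvd⟩).symm⟩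

end CenterQuotientRep

/-! ### The main theorem. -/

theorem mainTheorem6
    {R : Type*} [Field R] [IsAlgClosed R]
    {G : Type*} [Group G] [TopologicalSpace G] [IsTopologicalGroup G]
    [T2Space G] [LocallyCompactSpace G] [TotallyDisconnectedSpace G]
    (hG : ∃ K : OpenSubgroup G, IsCompact (K : Set G) ∧ HasInvertibleProOrder R K)
    (N : Subgroup G) (hNclosed : IsClosed (N : Set G)) (hN : IsExhaustedByCompacts R N)
    (θ : N →* Rˣ) (hθ : IsSmoothChar θ)
    {V : Type*} [AddCommGroup V] [Module R V] (π : Representation R G V)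
    (hsmooth : IsSmoothRep π) (hirr : π.IsIrreducible) (hadm : IsAdmissibleRep π)
    (hZ : IsZCompact π)
    (hZN : IsClosed ((Subgroup.center G ⊔ N : Subgroup G) : Set G))
    (hagree : ∀ (g : G) (hz : g ∈ Subgroup.center G) (hn : g ∈ N),
      centralCharacter π ⟨g, hz⟩ = θ ⟨g, hn⟩)
    (hχ : IsSmoothChar (centralMulChar (centralCharacter π) θ hagree))
    (hfin : FiniteDimensional R (whittakerSpace π θ)) :
    (∀ W : Submodule R (G → R), IsWhittakerModel π θ W →
      W ≤ compactInd (Subgroup.center G ⊔ N)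
        (centralMulChar (centralCharacter π) θ hagree)) ∧
    (∀ vd ∈ contragredient π, ∀ v : V,
      IsLocallyConstant
        (periodIntegrand π (centralMulChar (centralCharacter π) θ hagree) vd v) ∧
      HasCompactSupport
        (periodIntegrand π (centralMulChar (centralCharacter π) θ hagree) vd v)) ∧
    (∃ K : OpenSubgroup (CenterQuotient N),
      IsCompact (K : Set (CenterQuotient N)) ∧ HasInvertibleProOrder R K) ∧
    (∀ K : OpenSubgroup (CenterQuotient N),
      IsCompact (K : Set (CenterQuotient N)) → HasInvertibleProOrder R K →
      {f : V → R | ∃ L ∈ whittakerSpace π θ, f = L} =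
        {f : V → R | ∃ vd ∈ contragredient π,
          f = whittakerPeriod π (centralMulChar (centralCharacter π) θ hagree) K vd}) := by
  have hω := centralCharacter_spec (exists_centralCharacter hG hsmooth hirr hadm)
  have hχZ : ∀ h : ↥(Subgroup.center G ⊔ N), (h : G) ∈ Subgroup.center G →
      ∀ v, π h v = (centralMulChar (centralCharacter π) θ hagree h : R) • v := fun h hh v => by
    rw [centralMulChar_apply _ θ hagree h ⟨h, hh⟩ 1 (mul_one _), map_one, mul_one]
    exact hω ⟨h, hh⟩ v
  have hperiods := fun K hK => setOf_whittakerSpace_eq_periods hG hN hsmooth hirr hZ hZN hω hagree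
    hχZ hχ hfin K hK
  have hK := exists_compactOpen_quotient hG _ hZN
    ((Subgroup.center G).subgroupOf (Subgroup.center G ⊔ N))
  refine ⟨?_, fun vd hvd v => ⟨?_, ?_⟩, hK, fun K _ hK => hperiods K hK⟩
  · rintro _ ⟨L, -, rfl⟩ _ ⟨_, ⟨v, rfl⟩, rfl⟩
    have hL : ∀ g v x, (L (π g v) : G → R) x = (L v : G → R) (x * g) := fun g v x =>
      congrFun (congrArg Subtype.val (LinearMap.congr_fun (L.isIntertwining' g) v)) x
    -- Frobenius reciprocity: evaluation at `1` recovers the embedding as `g ↦ l (π g v)`.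
    let l : Module.Dual R V :=
      LinearMap.proj (1 : G) ∘ₗ (smoothInd N θ).subtype ∘ₗ L.toLinearMap
    have hl : ∀ g, (L v : G → R) g = l (π g v) := fun g => by
      rw [← one_mul g, ← hL, one_mul]; rfl
    have hlW : l ∈ whittakerSpace π θ := fun n w => by
      have h1 := (L w).2.1 n 1
      rw [mul_one] at h1
      change (L (π n w) : G → R) 1 = _ * (L w : G → R) 1
      rw [hL, one_mul, h1]
    obtain ⟨K, -, hK⟩ := hK
    obtain ⟨vd, hvd, hlvd⟩ : (l : V → R) ∈ {f : V → R | ∃ vd ∈ contragredient π,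
        f = whittakerPeriod π (centralMulChar (centralCharacter π) θ hagree) K vd} := by
      rw [← hperiods K hK]
      exact ⟨l, hlW, rfl⟩
    refine ⟨⟨fun h g => ?_, (L v).2.2⟩, ?_⟩
    · change (L v : G → R) (h * g) = _ * (L v : G → R) g
      have h1 := (mem_whittakerSpace_iff hω hagree hχZ).1 hlW (QuotientGroup.mk h) (π g v)
      rw [centerQuotientRep_mk, map_smul, smul_eq_mul, Units.inv_mul_eq_iff_eq_mul] at h1
      rw [hl, hl, map_mul, Module.End.mul_apply, h1]
    · have h1 := hasCompactSupportMod_whittakerPeriod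
        (χ := centralMulChar (centralCharacter π) θ hagree) hZ K hvd v
      rw [← hlvd] at h1
      have h2 : (fun g => l (π g v)) = (L v : G → R) := funext fun g => (hl g).symm
      rw [h2] at h1
      exact h1
  · rw [periodIntegrand_eq_coeff (hχ := hχZ), IsLocallyConstant.iff_exists_open]
    obtain ⟨U, hU⟩ := centerQuotientRep_smooth (hχ := hχZ) hsmooth hχ v
    intro q
    -- The neighbourhood is `q U`, with `U` fixing `v`.
    refine ⟨(fun x => q⁻¹ * x) ⁻¹' U, U.isOpen.preimage (continuous_const_mul _), ?_, ?_⟩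
    · simp [one_mem]
    · intro x hx
      conv_rhs => rw [← hU _ hx]
      rw [← Module.End.mul_apply, ← map_mul, mul_inv_cancel_left]
  · rw [periodIntegrand_eq_coeff (hχ := hχZ)]
    obtain ⟨C, hC, hsupp⟩ :=
      (contragredient_le_compactFunctionals (hχ := hχZ) hχ hZ hZN hvd).2 v
    exact exists_compact_iff_hasCompactSupport.1
      ⟨C, hC, fun x hx => by_contra fun h => hx (hsupp h)⟩
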